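/- Let $\Lambda=\mathcal K\mathcal Q/\langle\rho\rangle$ be a string algebra over an algebraically closed field: $\mathcal Q=(Q_0,Q_1,s,t)$ is a finite quiver in which every vertex has indegree and outdegree at most $2$; $\rho$ is a set of paths, none a proper subpath of another, generating an admissible ideal; and for each $a\in Q_1$ there is at most one $b\in Q_1$ with $s(b)=t(a)$, $ba\notin\langle\rho\rangle$, and at most one $b\in Q_1$ with $t(b)=s(a)$, $ab\notin\langle\rho\rangle$. Fix a bisection, i.e. maps $\sigma,\varepsilon:Q_1\to\{1,-1\}$ such that $\sigma(a)=-\sigma(b)$ for distinct $a,b$ with the same source, $\varepsilon(a)=-\varepsilon(b)$ for distinct $a,b$ with the same target, and $\sigma(b)=-\varepsilon(a)$ whenever $t(a)=s(b)$ and $ba\notin\langle\rho\rangle$. Syllables are arrows $a\in Q_1$ (direct) and their formal inverses $a^{-1}\in Q_1^{-}$ (inverse), with $s(a^{-1})=t(a)$, $t(a^{-1})=s(a)$, $\sigma(a^{-1})=\varepsilon(a)$, $\varepsilon(a^{-1})=\sigma(a)$. A string is either $1_{(v,j)}$ with $v\in Q_0$, $j=\pm1$ (length $0$; inverse $1_{(v,-j)}$),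 or a word $\alpha_n\cdots\alpha_1$ ($n\ge1$) of syllables with $s(\alpha_{k+1})=t(\alpha_k)$, having no subword in $\rho\cup\rho^{-1}$ and no two consecutive mutually inverse syllables. For such a word $\mathfrak u$ put $s(\mathfrak u)=s(\alpha_1)$, $\sigma(\mathfrak u)=\sigma(\alpha_1)$, $t(\mathfrak u)=t(\alpha_n)$, $\varepsilon(\mathfrak u)=\varepsilon(\alpha_n)$; put $s(1_{(v,j)})=t(1_{(v,j)})=v$ and $\sigma(1_{(v,j)})=-j=-\varepsilon(1_{(v,j)})$. Words of positive length are composed by concatenation; $1_{(v,j)}\mathfrak u=\mathfrak u$ is defined if $t(\mathfrak u)=v$, $\varepsilon(\mathfrak u)=j$, and $\mathfrak u1_{(v,j)}=\mathfrak u$ is defined if $s(\mathfrak u)=v$, $\sigma(\mathfrak u)=-j$. A band is a string $\mathfrak b=\alpha_n\cdots\alpha_1$ with $\alpha_n$ direct and $\alpha_1$ inverse, such that $\mathfrak b^2$ is a string and $\mathfrak b$ is not an $m$-th power of a string for any $m\ge2$. Fix a set $\mathcal Q^{\mathrm{Ba}}_0$ of representatives of the bands up to cyclic permutation of syllables. For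 $\mathfrak b_1,\mathfrak b_2\in\mathcal Q^{\mathrm{Ba}}_0$ write $\mathfrak b_1\preceq\mathfrak b_2$ if $\mathfrak b_2\mathfrak u\mathfrak b_1$ is a string for some string $\mathfrak u$; let $\approx$ be the equivalence relation $\preceq\cap\succeq$. Call a $\approx$-class $\mathsf B$ domestic if $|\mathsf B|=1$. For a string $\mathfrak x_0$ let $H_l(\mathfrak x_0)$ be the set of strings of the form $\mathfrak w\mathfrak x_0$ with $\mathfrak w$ a string, linearly ordered by: $\mathfrak x<_l\mathfrak y$ if $\mathfrak y=\mathfrak u\alpha\mathfrak x$, or $\mathfrak x=\mathfrak v\beta\mathfrak y$, or both $\mathfrak x=\mathfrak v\beta\mathfrak w$ and $\mathfrak y=\mathfrak u\alpha\mathfrak w$, for some inverse syllable $\alpha$, direct syllable $\beta$ and strings $\mathfrak u,\mathfrak v,\mathfrak w$. Dually, $H_r(\mathfrak x_0)$ is the set of strings $\mathfrak x_0\mathfrak w$ with $\mathfrak w$ a string, ordered by $\mathfrak x<_r\mathfrak y\iff\mathfrak x^{-1}<_l\mathfrak y^{-1}$. Let $H^1_l(\mathfrak x_0)$ (resp. $H^{-1}_l(\mathfrak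 x_0)$) consist of $\mathfrak x_0$ and all $\mathfrak w\mathfrak x_0\in H_l(\mathfrak x_0)$ with $|\mathfrak w|>0$ in which the syllable of $\mathfrak w$ adjacent to $\mathfrak x_0$ is inverse (resp. direct); define $H^{\pm1}_r(\mathfrak x_0)$ likewise with $\mathfrak x_0\mathfrak w$; and set $H^0_l(\mathfrak x_0)=H^0_r(\mathfrak x_0)=\{\mathfrak x_0\}$. A class $\mathsf B$ is visible from $H^i_l(\mathfrak x_0)$ (resp. from $H^i_r(\mathfrak x_0)$) if there are $\mathfrak b\in\mathsf B$ and a string $\mathfrak u$ with $\mathfrak b\mathfrak u\mathfrak x_0\in H^i_l(\mathfrak x_0)$ (resp. $\mathfrak x_0\mathfrak u\mathfrak b\in H^i_r(\mathfrak x_0)$). A linear order is scattered if $\mathbb Q$ does not embed into it. Theorem. For every string $\mathfrak x_0$ and every $i\in\{1,0,-1\}$, the linear order $(H^i_l(\mathfrak x_0),<_l)$ is scattered if and only if every class visible from $H^i_l(\mathfrak x_0)$ is domestic. Similarly, $(H^i_r(\mathfrak x_0),<_r)$ is scattered if and only if every class visible from $H^i_r(\mathfrak x_0)$ is domestic. 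-/

import Mathlib

/-- A path `p` lies in the monomial ideal `⟨ρ⟩` of the path algebra: since `ρ` consists of paths, this
means that `p` has a contiguous subpath in `ρ`. -/
def InMonomialIdeal {E : Type*} (ρ : Set (List E)) (p : List E) : Prop := ∃ r ∈ ρ, r <:+: p

/-- A presentation `(Q, ρ)` of a string algebra `Λ = KQ/⟨ρ⟩`, with vertex set `V = Q₀` and arrow set
`E = Q₁`, together with a chosen bisection `(σ, ε)`.

Paths are lists of arrows in the written order `aₙ ⋯ a₂ a₁`, so that consecutive entries `b, a`
satisfy `s(b) = t(a)`. The base field plays no role in the combinatorics. -/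
structure StringAlgebra (V E : Type*) where
  /-- source of an arrow -/
  s : E → V
  /-- target of an arrow -/
  t : E → V
  /-- the monomial relations -/
  ρ : Set (List E)
  /-- the bisection, at sources -/
  σ : E → ℤˣ
  /-- the bisection, at targets -/
  ε : E → ℤˣ
  outdegree_le : ∀ v, {a | s a = v}.encard ≤ 2
  indegree_le : ∀ v, {a | t a = v}.encard ≤ 2
  rel_isPath : ∀ p ∈ ρ, p.IsChain (fun b a => s b = t a)
  /-- `⟨ρ⟩` is admissible: all relations have length at least `2` … -/
  two_le_length : ∀ p ∈ ρ, 2 ≤ p.length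
  /-- … and all sufficiently long paths lie in `⟨ρ⟩`. -/
  exists_bound : ∃ m : ℕ, ∀ p : List E, p.IsChain (fun b a => s b = t a) → m ≤ p.length →
    InMonomialIdeal ρ p
  /-- No path in `ρ` has a proper subpath in `ρ`. -/
  rel_minimal : ∀ p ∈ ρ, ∀ q ∈ ρ, q <:+: p → q = p
  unique_after : ∀ a b b', s b = t a → s b' = t a →
    ¬ InMonomialIdeal ρ [b, a] → ¬ InMonomialIdeal ρ [b', a] → b = b'
  unique_before : ∀ a b b', t b = s a → t b' = s a →
    ¬ InMonomialIdeal ρ [a, b] → ¬ InMonomialIdeal ρ [a, b'] → b = b'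
  σ_eq_neg : ∀ a b, a ≠ b → s a = s b → σ a = - σ b
  ε_eq_neg : ∀ a b, a ≠ b → t a = t b → ε a = - ε b
  σ_eq_neg_ε : ∀ a b, t a = s b → ¬ InMonomialIdeal ρ [b, a] → σ b = - ε a

/-- A syllable: an arrow `a ∈ Q₁` or its formal inverse `A ∈ Q₁⁻`. -/
inductive Syllable (E : Type*)
  | direct (a : E)
  | inverse (a : E)

namespace Syllable

variable {E : Type*}

/-- The inverse syllable. -/
def inv : Syllable E → Syllable E
  | direct a => inverse a
  | inverse a => direct a

/-- `1` for inverse syllables and `-1` for direct ones. -/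
def sign : Syllable E → SignType
  | direct _ => -1
  | inverse _ => 1

end Syllable

/-- The underlying data of words: a zero-length path `1_{(v,i)}` with `i = ±1`, or a nonempty list
of syllables in the written order `αₙ ⋯ α₂ α₁`. (Whether consecutive syllables are composable is
part of `StringAlgebra.IsString`.) -/
inductive Word (V E : Type*)
  | triv (v : V) (i : ℤˣ)
  | path (l : List (Syllable E)) (hl : l ≠ [])

namespace Word

variable {V E : Type*}

/-- The list of syllables, in the written order. -/
def syl : Word V E → List (Syllable E)
  | triv _ _ => []
  | path l _ => l

/-- The inverse word. -/
def inv : Word V E → Word V E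
  | triv v i => triv v (-i)
  | path l hl => path (l.map Syllable.inv).reverse (by simpa using hl)

/-- The length of a word. -/
def length (x : Word V E) : ℕ := x.syl.length

/-- The word with a single syllable. -/
def single (α : Syllable E) : Word V E := path [α] (by simp)

/-- `θ_l`: `1` if the first syllable `α₁` is inverse, `-1` if it is direct
(with value `0` on words of length zero, where `θ_l` is not defined). -/
def thetaL : Word V E → SignType
  | triv _ _ => 0
  | path l hl => (l.getLast hl).sign

/-- `θ_r`: `1` if the last syllable `αₙ` is inverse, `-1` if it is direct
(with value `0` on words of length zero, where `θ_r` is not defined). -/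
def thetaR : Word V E → SignType
  | triv _ _ => 0
  | path l hl => (l.head hl).sign

end Word

namespace StringAlgebra

variable {V E : Type*} (Λ : StringAlgebra V E)

/-- Source of a syllable. -/
def src : Syllable E → V
  | .direct a => Λ.s a
  | .inverse a => Λ.t a

/-- Target of a syllable. -/
def tgt : Syllable E → V
  | .direct a => Λ.t a
  | .inverse a => Λ.s a

/-- `σ` on syllables. -/
def sig : Syllable E → ℤˣ
  | .direct a => Λ.σ a
  | .inverse a => Λ.ε a

/-- `ε` on syllables. -/
def eps : Syllable E → ℤˣ
  | .direct a => Λ.ε a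
  | .inverse a => Λ.σ a

/-- Source of a word. -/
def wsrc : Word V E → V
  | .triv v _ => v
  | .path l hl => Λ.src (l.getLast hl)

/-- Target of a word. -/
def wtgt : Word V E → V
  | .triv v _ => v
  | .path l hl => Λ.tgt (l.head hl)

/-- `σ` on words; `σ(1_{(v,i)}) = -i`. -/
def wsig : Word V E → ℤˣ
  | .triv _ i => -i
  | .path l hl => Λ.sig (l.getLast hl)

/-- `ε` on words; `ε(1_{(v,i)}) = i`. -/
def weps : Word V E → ℤˣ
  | .triv _ i => i
  | .path l hl => Λ.eps (l.head hl)

/-- A string: a word (consecutive syllables are composable) which has no subpath in `ρ ∪ ρ⁻¹`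
and no two consecutive syllables that are inverse to each other. -/
def IsString (x : Word V E) : Prop :=
  x.syl.IsChain (fun β α => Λ.src β = Λ.tgt α) ∧
  (∀ p ∈ Λ.ρ, ¬ p.map Syllable.direct <:+: x.syl) ∧
  (∀ p ∈ Λ.ρ, ¬ (p.map Syllable.inverse).reverse <:+: x.syl) ∧
  x.syl.IsChain (fun β α => β ≠ α.inv)

/-- `Λ.Comp u x y`: the composition `u x` of words is defined and equal to `y`. -/
inductive Comp : Word V E → Word V E → Word V E → Prop
  | triv_left (v : V) (i : ℤˣ) (x : Word V E) (ht : Λ.wtgt x = v) (hε : Λ.weps x = i) :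
      Comp (.triv v i) x x
  | triv_right (u : Word V E) (v : V) (i : ℤˣ) (hs : Λ.wsrc u = v) (hσ : Λ.wsig u = -i) :
      Comp u (.triv v i) u
  | path (l m : List (Syllable E)) (hl : l ≠ []) (hm : m ≠ [])
      (h : Λ.wsrc (.path l hl) = Λ.wtgt (.path m hm)) :
      Comp (.path l hl) (.path m hm) (.path (l ++ m) (by simp [hl]))

/-- `Λ.Comp₃ u w x y`: the composition `u w x` is defined and equal to `y`. -/
def Comp₃ (u w x y : Word V E) : Prop := ∃ z, Λ.Comp w x z ∧ Λ.Comp u z y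

/-- `x` is a left substring of `y`: `y = u x` for some string `u`. -/
def LeftSubstring (x y : Word V E) : Prop := ∃ u, Λ.IsString u ∧ Λ.Comp u x y

/-- `x` is a right substring of `y`: `y = x u` for some string `u`. -/
def RightSubstring (x y : Word V E) : Prop := ∃ u, Λ.IsString u ∧ Λ.Comp x u y

/-- The left hammock set `H_l(x₀)`. -/
def leftHammock (x₀ : Word V E) : Set (Word V E) := {x | Λ.IsString x ∧ Λ.LeftSubstring x₀ x}

/-- The right hammock set `H_r(x₀)`. -/
def rightHammock (x₀ : Word V E) : Set (Word V E) := {x | Λ.IsString x ∧ Λ.RightSubstring x₀ x}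

/-- The relation `x <_l y`. -/
def leftLT (x y : Word V E) : Prop :=
  (∃ u a, Λ.IsString u ∧ Λ.Comp₃ u (.single (.inverse a)) x y) ∨
  (∃ v b, Λ.IsString v ∧ Λ.Comp₃ v (.single (.direct b)) y x) ∨
  (∃ u v w a b, Λ.IsString u ∧ Λ.IsString v ∧ Λ.IsString w ∧
    Λ.Comp₃ v (.single (.direct b)) w x ∧ Λ.Comp₃ u (.single (.inverse a)) w y)

/-- The relation `x <_r y`, i.e. `x⁻¹ <_l y⁻¹`. -/
def rightLT (x y : Word V E) : Prop := Λ.leftLT x.inv y.inv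

/-- The half hammock `H_l^i(x₀)`, `i ∈ {1, 0, -1}`; for `i = ±1` it consists of `x₀` and of those
`x = w x₀` in `H_l(x₀)` with `|w| > 0` and `θ_l(w) = i`. -/
def leftHalf (i : SignType) (x₀ : Word V E) : Set (Word V E) :=
  if i = 0 then {x₀} else
    {x ∈ Λ.leftHammock x₀ | x = x₀ ∨
      ∃ w, Λ.IsString w ∧ 0 < w.length ∧ Λ.Comp w x₀ x ∧ w.thetaL = i}

/-- The half hammock `H_r^i(x₀)`, `i ∈ {1, 0, -1}`; for `i = ±1` it consists of `x₀` and of those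
`x = x₀ w` in `H_r(x₀)` with `|w| > 0` and `θ_r(w) = i`. -/
def rightHalf (i : SignType) (x₀ : Word V E) : Set (Word V E) :=
  if i = 0 then {x₀} else
    {x ∈ Λ.rightHammock x₀ | x = x₀ ∨
      ∃ w, Λ.IsString w ∧ 0 < w.length ∧ Λ.Comp x₀ w x ∧ w.thetaR = i}

/-- A band: a string `b = αₙ ⋯ α₁` of positive length with `αₙ` direct and `α₁` inverse, such that
`b²` is a string and `b` is not an `n`-th power of a string for any `n ≥ 2`. -/
def IsBand (b : Word V E) : Prop :=
  Λ.IsString b ∧ b.thetaR = -1 ∧ b.thetaL = 1 ∧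
  (∃ c, Λ.Comp b b c ∧ Λ.IsString c) ∧
  ∀ c : Word V E, Λ.IsString c → ∀ n : ℕ, 2 ≤ n → b.syl ≠ (List.replicate n c.syl).flatten

/-- `Q₀` is a set of representatives for the bands up to cyclic permutation of syllables. -/
def IsBandRepresentatives (Q₀ : Set (Word V E)) : Prop :=
  (∀ b ∈ Q₀, Λ.IsBand b) ∧ ∀ b, Λ.IsBand b → ∃! b', b' ∈ Q₀ ∧ b'.syl ~r b.syl

/-- The relation `b₁ ≼ b₂`: there is a string `u` such that `b₂ u b₁` is a string. -/
def BandLE (b₁ b₂ : Word V E) : Prop :=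
  ∃ u y, Λ.IsString u ∧ Λ.Comp₃ b₂ u b₁ y ∧ Λ.IsString y

/-- The set of equivalence classes of the set of bands `Q₀` under `≈ := ≼ ∩ ≽`. -/
def bandClasses (Q₀ : Set (Word V E)) : Set (Set (Word V E)) :=
  {B | ∃ b ∈ Q₀, B = {b' ∈ Q₀ | Λ.BandLE b b' ∧ Λ.BandLE b' b}}

/-- The bands in `Q₀` that are visible from `H_l^i(x)`. -/
def leftVisibleBands (Q₀ : Set (Word V E)) (i : SignType) (x : Word V E) : Set (Word V E) :=
  {b ∈ Q₀ | ∃ u y, Λ.IsString u ∧ Λ.Comp₃ b u x y ∧ y ∈ Λ.leftHalf i x}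

/-- The bands in `Q₀` that are visible from `H_r^i(x)`. -/
def rightVisibleBands (Q₀ : Set (Word V E)) (i : SignType) (x : Word V E) : Set (Word V E) :=
  {b ∈ Q₀ | ∃ u y, Λ.IsString u ∧ Λ.Comp₃ x u b y ∧ y ∈ Λ.rightHalf i x}

/-- The band classes visible from `H_l^i(x)`. -/
def leftVisibleClasses (Q₀ : Set (Word V E)) (i : SignType) (x : Word V E) :
    Set (Set (Word V E)) :=
  {B ∈ Λ.bandClasses Q₀ | (B ∩ Λ.leftVisibleBands Q₀ i x).Nonempty}

/-- The band classes visible from `H_r^i(x)`. -/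
def rightVisibleClasses (Q₀ : Set (Word V E)) (i : SignType) (x : Word V E) :
    Set (Set (Word V E)) :=
  {B ∈ Λ.bandClasses Q₀ | (B ∩ Λ.rightVisibleBands Q₀ i x).Nonempty}

/-- A class of bands is domestic if it has exactly one element. -/
def IsDomestic (B : Set (Word V E)) : Prop := B.encard = 1

end StringAlgebra

/-! ### The hammocks are linearly ordered -/

namespace Word

variable {V E : Type*}

theorem path_ext {x : Word V E} {l : List (Syllable E)} (hl : l ≠ []) (h : x.syl = l) :
    x = .path l hl := by
  cases x with
  | triv v i => exact absurd h.symm hl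
  | path m hm => subst h; rfl

end Word

theorem Syllable.inv_inv {E : Type*} (α : Syllable E) : α.inv.inv = α := by cases α <;> rfl

namespace StringAlgebra

variable {V E : Type*} (Λ : StringAlgebra V E)

theorem word_ext {x y : Word V E} (h : x.syl = y.syl) (hs : Λ.wsrc x = Λ.wsrc y)
    (hσ : Λ.wsig x = Λ.wsig y) : x = y := by
  cases x with
  | triv v i =>
    cases y with
    | triv w j => simp_all [wsrc, wsig]
    | path m hm => exact absurd h.symm hm
  | path l hl =>
    cases y with
    | triv w j => exact absurd h hl
    | path m hm => cases h; rfl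

variable {Λ}

theorem Comp.syl_eq {u x y : Word V E} (h : Λ.Comp u x y) : y.syl = u.syl ++ x.syl := by
  cases h <;> simp [Word.syl]

theorem Comp.start {u x y : Word V E} (h : Λ.Comp u x y) :
    Λ.wsrc y = Λ.wsrc x ∧ Λ.wsig y = Λ.wsig x := by
  cases h with
  | triv_left => exact ⟨rfl, rfl⟩
  | triv_right _ v i hs hσ => exact ⟨hs, hσ⟩
  | path l m hl hm h => simp [wsrc, wsig, hm]

theorem IsString.infix {x y : Word V E} (hx : Λ.IsString x) (h : y.syl <:+: x.syl) :
    Λ.IsString y :=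
  ⟨hx.1.infix h, fun p hp hi => hx.2.1 p hp (hi.trans h),
    fun p hp hi => hx.2.2.1 p hp (hi.trans h), hx.2.2.2.infix h⟩

theorem isString_triv (v : V) (i : ℤˣ) : Λ.IsString (.triv v i : Word V E) := by
  refine ⟨.nil, fun p hp h => ?_, fun p hp h => ?_, .nil⟩ <;>
  · have := Λ.two_le_length p hp
    have h' : p = [] := by simpa [Word.syl] using h
    simp [h'] at this

theorem exists_prefix {x : Word V E} (hx : Λ.IsString x) (l₁ l₂ : List (Syllable E))
    (h : x.syl = l₁ ++ l₂) :
    ∃ w, Λ.IsString w ∧ w.syl = l₂ ∧ Λ.wsrc w = Λ.wsrc x ∧ Λ.wsig w = Λ.wsig x := by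
  by_cases h2 : l₂ = []
  · exact ⟨.triv (Λ.wsrc x) (-Λ.wsig x), isString_triv _ _, h2.symm, rfl, by simp [wsig]⟩
  · refine ⟨.path l₂ h2, hx.infix ?_, rfl, ?_⟩
    · rw [h]; exact (List.suffix_append _ _).isInfix
    · rw [Word.path_ext (x := x) (by simp [h2]) h]
      simp [wsrc, wsig, h2]

theorem exists_split {x w : Word V E} (hx : Λ.IsString x) (l : List (Syllable E))
    (h : x.syl = l ++ w.syl) (hs : Λ.wsrc w = Λ.wsrc x) (hσ : Λ.wsig w = Λ.wsig x) :
    ∃ u, Λ.IsString u ∧ u.syl = l ∧ Λ.Comp u w x := by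
  by_cases hl : l = []
  · subst hl
    obtain rfl := Λ.word_ext h hs.symm hσ.symm
    exact ⟨.triv (Λ.wtgt x) (Λ.weps x), isString_triv _ _, rfl, .triv_left _ _ _ rfl rfl⟩
  · refine ⟨.path l hl, hx.infix ?_, rfl, ?_⟩
    · rw [h]; exact (List.prefix_append _ _).isInfix
    · cases w with
      | triv v i =>
        have hx' := Word.path_ext (x := x) hl (by simpa [Word.syl] using h)
        subst hx'
        exact .triv_right _ _ _ hs.symm hσ.symm
      | path m hm =>
        have hx' := Word.path_ext (x := x) (l := l ++ m) (by simp [hl]) h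
        subst hx'
        refine .path _ _ _ _ ?_
        have h1 := hx.1
        simp only [Word.syl, List.isChain_append] at h1
        exact h1.2.2 _ (by simp [List.getLast?_eq_getLast_of_ne_nil hl]) _
          (by simp [List.head?_eq_some_head hm])

/-- The bisection determines the sign of a syllable from the preceding one. -/
theorem sig_step {β α : Syllable E} (hc : Λ.src β = Λ.tgt α) (hi : β ≠ α.inv)
    (h1 : ∀ p ∈ Λ.ρ, ¬ p.map Syllable.direct <:+: [β, α])
    (h2 : ∀ p ∈ Λ.ρ, ¬ (p.map Syllable.inverse).reverse <:+: [β, α]) : Λ.sig β = - Λ.eps α := by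
  cases β with
  | direct b =>
    cases α with
    | direct a =>
      refine Λ.σ_eq_neg_ε a b hc.symm ?_
      rintro ⟨p, hp, hr⟩
      exact h1 p hp (by simpa using hr.map Syllable.direct)
    | inverse a =>
      exact Λ.σ_eq_neg b a (fun h => hi (by rw [h]; rfl)) hc
  | inverse b =>
    cases α with
    | direct a =>
      exact Λ.ε_eq_neg b a (fun h => hi (by rw [h]; rfl)) hc
    | inverse a =>
      have := Λ.σ_eq_neg_ε b a hc ?_
      · simp only [sig, eps]; rw [this, neg_neg]
      · rintro ⟨p, hp, hr⟩
        refine h2 p hp ?_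
        have := List.reverse_infix.2 (hr.map Syllable.inverse)
        simpa using this

theorem IsString.next {z w : Word V E} {β : Syllable E} (hz : Λ.IsString z)
    (h : z.syl = β :: w.syl) (hs : Λ.wsrc w = Λ.wsrc z) (hσ : Λ.wsig w = Λ.wsig z) :
    Λ.src β = Λ.wtgt w ∧ Λ.sig β = - Λ.weps w := by
  have hz' := Word.path_ext (x := z) (by simp) h
  cases w with
  | triv v i =>
    subst hz'
    simp only [wsrc, wsig, Word.syl, List.getLast_singleton] at hs hσ
    exact ⟨hs.symm, hσ.symm⟩
  | path m hm =>
    obtain ⟨γ, m, rfl⟩ := List.exists_cons_of_ne_nil hm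
    obtain ⟨c1, c2, c3, c4⟩ := hz
    rw [h] at c1 c2 c3 c4
    simp only [Word.syl, List.isChain_cons_cons] at c1 c2 c3 c4
    have hinf : [β, γ] <:+: β :: γ :: m := (List.prefix_append [β, γ] m).isInfix
    exact ⟨c1.1, sig_step c1.1 c4.1 (fun p hp hh => c2 p hp (hh.trans hinf))
      (fun p hp hh => c3 p hp (hh.trans hinf))⟩

theorem syllable_ext {α β : Syllable E} (hs : Λ.src α = Λ.src β) (hσ : Λ.sig α = Λ.sig β)
    (h : α.sign = β.sign) : α = β := by
  have key : ∀ u : ℤˣ, u ≠ -u := by decide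
  cases α with
  | direct a =>
    cases β with
    | direct b =>
      by_contra hne
      have := Λ.σ_eq_neg a b (fun h => hne (by rw [h])) hs
      simp only [sig] at hσ
      exact key _ (hσ.symm.trans this)
    | inverse b => simp [Syllable.sign] at h
  | inverse a =>
    cases β with
    | direct b => simp [Syllable.sign] at h
    | inverse b =>
      by_contra hne
      have := Λ.ε_eq_neg a b (fun h => hne (by rw [h])) hs
      simp only [sig] at hσ
      exact key _ (hσ.symm.trans this)

/-- The signs of the syllables of a word, read from the first syllable on and continued by `0`. -/
def code (x : Word V E) (n : ℕ) : SignType :=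
  ((x.syl.reverse[n]?).map Syllable.sign).getD 0

theorem code_lt_of_leftLT {x y : Word V E} (h : Λ.leftLT x y) :
    ∃ n, (∀ k < n, code x k = code y k) ∧ code x n < code y n := by
  have three : ∀ {u w z : Word V E} {α : Syllable E}, Λ.Comp₃ u (.single α) w z →
      z.syl.reverse = w.syl.reverse ++ α :: u.syl.reverse := by
    rintro u w z α ⟨z', h1, h2⟩
    rw [h2.syl_eq, h1.syl_eq]; simp [Word.single, Word.syl]
  rcases h with ⟨u, a, -, h⟩ | ⟨v, b, -, h⟩ | ⟨u, v, w, a, b, -, -, -, h, h'⟩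
  · refine ⟨x.syl.length, fun k hk => ?_, ?_⟩
    · simp [code, three h, List.getElem?_append, hk]
    · simp [code, three h, Syllable.sign]
  · refine ⟨y.syl.length, fun k hk => ?_, ?_⟩
    · simp [code, three h, List.getElem?_append, hk]
    · simp [code, three h, Syllable.sign]
  · refine ⟨w.syl.length, fun k hk => ?_, ?_⟩
    · simp [code, three h, three h', List.getElem?_append, hk]
    · simp [code, three h, three h', Syllable.sign]

theorem IsString.next₃ {x w : Word V E} (hx : Λ.IsString x) {l : List (Syllable E)}
    {β : Syllable E} (h : x.syl = l ++ β :: w.syl) (hs : Λ.wsrc w = Λ.wsrc x)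
    (hσ : Λ.wsig w = Λ.wsig x) :
    Λ.src β = Λ.wtgt w ∧ Λ.sig β = - Λ.weps w ∧
      ∃ u, Λ.IsString u ∧ Λ.Comp₃ u (.single β) w x := by
  obtain ⟨z, hz, hzl, hzs, hzσ⟩ := exists_prefix hx l (β :: w.syl) h
  obtain ⟨h1, h2⟩ := hz.next hzl (hs.trans hzs.symm) (hσ.trans hzσ.symm)
  obtain ⟨u, hu, -, huc⟩ := exists_split (w := z) hx l (by rw [hzl, h]) hzs hzσ
  obtain ⟨v, -, hvl, hvc⟩ := exists_split (w := w) hz [β] (by rw [hzl]; rfl)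
    (hs.trans hzs.symm) (hσ.trans hzσ.symm)
  obtain rfl : v = .single β := Word.path_ext (by simp) hvl
  exact ⟨h1, h2, u, hu, z, hvc, huc⟩

theorem list_compare {α : Type*} : ∀ A B : List α, A = B ∨ (∃ b T, B = A ++ b :: T) ∨
    (∃ a S, A = B ++ a :: S) ∨
    ∃ P a b S T, a ≠ b ∧ A = P ++ a :: S ∧ B = P ++ b :: T
  | [], [] => .inl rfl
  | [], b :: T => .inr (.inl ⟨b, T, rfl⟩)
  | a :: S, [] => .inr (.inr (.inl ⟨a, S, rfl⟩))
  | a :: S, b :: T => by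
    by_cases hab : a = b
    · subst hab
      rcases list_compare S T with rfl | ⟨b, T, rfl⟩ | ⟨b, T, rfl⟩ | ⟨P, c, d, S, T, h, rfl, rfl⟩
      · exact .inl rfl
      · exact .inr (.inl ⟨b, T, rfl⟩)
      · exact .inr (.inr (.inl ⟨b, T, rfl⟩))
      · exact .inr (.inr (.inr ⟨a :: P, c, d, S, T, h, rfl, rfl⟩))
    · exact .inr (.inr (.inr ⟨[], a, b, S, T, hab, rfl, rfl⟩))

theorem leftLT_trichotomy {x y : Word V E} (hx : Λ.IsString x) (hy : Λ.IsString y)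
    (hs : Λ.wsrc x = Λ.wsrc y) (hσ : Λ.wsig x = Λ.wsig y) :
    Λ.leftLT x y ∨ x = y ∨ Λ.leftLT y x := by
  have ext : ∀ {x y : Word V E} {b : Syllable E} {T : List (Syllable E)}, Λ.IsString y →
      Λ.wsrc x = Λ.wsrc y → Λ.wsig x = Λ.wsig y →
      y.syl.reverse = x.syl.reverse ++ b :: T → Λ.leftLT x y ∨ Λ.leftLT y x := by
    intro x y b T hy hs hσ h
    have h' : y.syl = T.reverse ++ b :: x.syl := by
      rw [← List.reverse_reverse y.syl, h]; simp
    obtain ⟨-, -, u, hu, hc⟩ := hy.next₃ h' hs hσ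
    cases b with
    | direct b => exact .inr (.inr (.inl ⟨u, b, hu, hc⟩))
    | inverse b => exact .inl (.inl ⟨u, b, hu, hc⟩)
  rcases list_compare x.syl.reverse y.syl.reverse with
    h | ⟨b, T, h⟩ | ⟨b, T, h⟩ | ⟨P, a, b, S, T, hab, h, h'⟩
  · exact .inr (.inl (Λ.word_ext (List.reverse_injective h) hs hσ))
  · rcases ext hy hs hσ h with h | h
    · exact .inl h
    · exact .inr (.inr h)
  · rcases ext hx hs.symm hσ.symm h with h | h
    · exact .inr (.inr h)
    · exact .inl h
  · have e : x.syl = (S.reverse ++ [a]) ++ P.reverse := by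
      rw [← List.reverse_reverse x.syl, h]; simp
    obtain ⟨w, hw, hwl, hws, hwσ⟩ := exists_prefix hx _ _ e
    have e1 : x.syl = S.reverse ++ a :: w.syl := by rw [hwl, e]; simp
    have e2 : y.syl = T.reverse ++ b :: w.syl := by
      rw [hwl, ← List.reverse_reverse y.syl, h']; simp
    obtain ⟨p1, p2, u, hu, hc⟩ := hx.next₃ e1 hws hwσ
    obtain ⟨q1, q2, v, hv, hd⟩ := hy.next₃ e2 (hws.trans hs) (hwσ.trans hσ)
    have hsign : a.sign ≠ b.sign := fun h0 =>
      hab (syllable_ext (p1.trans q1.symm) (p2.trans q2.symm) h0)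
    cases a with
    | direct a =>
      cases b with
      | direct b => exact absurd rfl hsign
      | inverse b => exact .inl (.inr (.inr ⟨v, u, w, b, a, hv, hu, hw, hc, hd⟩))
    | inverse a =>
      cases b with
      | direct b => exact .inr (.inr (.inr (.inr ⟨u, v, w, a, b, hu, hv, hw, hd, hc⟩)))
      | inverse b => exact absurd rfl hsign

/-- On any set of strings with the same starting data, `<_l` is a strict linear order. -/
theorem leftLT_isStrictTotalOrder {α : Type*} (f : α → Word V E) (hf : Function.Injective f)
    (hstr : ∀ a b, a ≠ b → Λ.IsString (f a))
    (hst : ∀ a b, Λ.wsrc (f a) = Λ.wsrc (f b) ∧ Λ.wsig (f a) = Λ.wsig (f b)) :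
    IsStrictTotalOrder α (fun a b => Λ.leftLT (f a) (f b)) := by
  have hlt : ∀ a b, Λ.leftLT (f a) (f b) → toLex (code (f a)) < toLex (code (f b)) :=
    fun a b h => code_lt_of_leftLT h
  have tri : ∀ a b, Λ.leftLT (f a) (f b) ∨ a = b ∨ Λ.leftLT (f b) (f a) := by
    intro a b
    by_cases hab : a = b
    · exact .inr (.inl hab)
    · rcases leftLT_trichotomy (hstr a b hab) (hstr b a (Ne.symm hab)) (hst a b).1 (hst a b).2 with
        h | h | h
      · exact .inl h
      · exact .inr (.inl (hf h))
      · exact .inr (.inr h)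
  refine { trichotomous := fun a b h1 h2 => ?_, irrefl := fun a h => (hlt a a h).false,
           trans := fun a b c h1 h2 => ?_ }
  · rcases tri a b with h | h | h
    · exact absurd h h1
    · exact h
    · exact absurd h h2
  · have h3 := (hlt _ _ h1).trans (hlt _ _ h2)
    rcases tri a c with h | h | h
    · exact h
    · subst h; exact h3.false.elim
    · exact (h3.trans (hlt _ _ h)).false.elim

variable (Λ) in
theorem leftHalf_cases {i : SignType} {x₀ x : Word V E} (hx : x ∈ Λ.leftHalf i x₀) :
    x = x₀ ∨ x ∈ Λ.leftHammock x₀ := by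
  unfold leftHalf at hx
  split_ifs at hx with h
  · exact .inl hx
  · exact .inr hx.1

variable (Λ) in
theorem leftHalf_start {i : SignType} {x₀ x : Word V E} (hx : x ∈ Λ.leftHalf i x₀) :
    Λ.wsrc x = Λ.wsrc x₀ ∧ Λ.wsig x = Λ.wsig x₀ := by
  rcases leftHalf_cases Λ hx with rfl | ⟨-, u, -, hu⟩
  · exact ⟨rfl, rfl⟩
  · exact hu.start

instance leftHalf_isStrictTotalOrder (i : SignType) (x₀ : Word V E) :
    IsStrictTotalOrder (Λ.leftHalf i x₀) (fun x y => Λ.leftLT x.1 y.1) := by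
  refine leftLT_isStrictTotalOrder Subtype.val Subtype.val_injective (fun x y hne => ?_)
    fun x y => ⟨(leftHalf_start Λ x.2).1.trans (leftHalf_start Λ y.2).1.symm,
      (leftHalf_start Λ x.2).2.trans (leftHalf_start Λ y.2).2.symm⟩
  by_cases h : i = 0
  · have hx := x.2
    have hy := y.2
    simp only [leftHalf, h, if_true, Set.mem_singleton_iff] at hx hy
    exact absurd (Subtype.ext (hx.trans hy.symm)) hne
  · have hx := x.2
    simp only [leftHalf, h, if_false] at hx
    exact hx.1.1

theorem inv_syl (x : Word V E) : x.inv.syl = (x.syl.map Syllable.inv).reverse := by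
  cases x <;> rfl

theorem inv_inv (x : Word V E) : x.inv.inv = x := by
  cases x with
  | triv v i => simp [Word.inv]
  | path l hl => simp [Word.inv, Function.comp_def, Syllable.inv_inv]

theorem inv_start (x : Word V E) : Λ.wsrc x.inv = Λ.wtgt x ∧ Λ.wsig x.inv = Λ.weps x := by
  cases x with
  | triv v i => simp [Word.inv, wsrc, wtgt, wsig, weps]
  | path l hl =>
    simp only [Word.inv, wsrc, wtgt, wsig, weps, List.getLast_reverse, List.head_map]
    cases l.head hl <;> exact ⟨rfl, rfl⟩

theorem Comp.finish {x u y : Word V E} (h : Λ.Comp x u y) :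
    Λ.wtgt y = Λ.wtgt x ∧ Λ.weps y = Λ.weps x := by
  cases h with
  | triv_left v i x ht hε => exact ⟨ht, hε⟩
  | triv_right => exact ⟨rfl, rfl⟩
  | path l m hl hm h => simp [wtgt, weps, List.head_append_of_ne_nil, hl]

theorem IsString.inv {x : Word V E} (hx : Λ.IsString x) : Λ.IsString x.inv := by
  obtain ⟨h1, h2, h3, h4⟩ := hx
  have hi : Syllable.inv ∘ Syllable.inverse = (Syllable.direct : E → _) := rfl
  have hii : Syllable.inv ∘ Syllable.inv = (id : Syllable E → _) := funext Syllable.inv_inv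
  have hd : Syllable.inv ∘ Syllable.direct = (Syllable.inverse : E → _) := rfl
  refine ⟨?_, fun p hp h => ?_, fun p hp h => ?_, ?_⟩
  · rw [inv_syl, List.isChain_reverse, List.isChain_map]
    refine h1.imp fun β α h => ?_
    cases α <;> cases β <;> exact h.symm
  · refine h3 p hp ?_
    rw [inv_syl] at h
    have := List.reverse_infix.2 (h.map Syllable.inv)
    simpa [hii, hd] using this
  · refine h2 p hp ?_
    rw [inv_syl, List.reverse_infix] at h
    simpa [hii, hi] using h.map Syllable.inv
  · rw [inv_syl, List.isChain_reverse, List.isChain_map]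
    refine h4.imp fun β α h h' => h ?_
    rw [h', Syllable.inv_inv]

variable (Λ) in
theorem rightHalf_finish {i : SignType} {x₀ x : Word V E} (hx : x ∈ Λ.rightHalf i x₀) :
    Λ.wtgt x = Λ.wtgt x₀ ∧ Λ.weps x = Λ.weps x₀ := by
  unfold rightHalf at hx
  split_ifs at hx with h
  · rw [Set.mem_singleton_iff] at hx
    subst hx
    exact ⟨rfl, rfl⟩
  · obtain ⟨⟨-, u, -, hu⟩, -⟩ := hx
    exact hu.finish

instance rightHalf_isStrictTotalOrder (i : SignType) (x₀ : Word V E) :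
    IsStrictTotalOrder (Λ.rightHalf i x₀) (fun x y => Λ.rightLT x.1 y.1) := by
  refine leftLT_isStrictTotalOrder (fun x : Λ.rightHalf i x₀ => x.1.inv)
    (fun x y h => Subtype.ext ?_) (fun x y hne => ?_)
    fun x y => ⟨?_, ?_⟩
  · rw [← inv_inv x.1, ← inv_inv y.1]; exact congrArg Word.inv h
  · by_cases h : i = 0
    · have hx := x.2
      have hy := y.2
      simp only [rightHalf, h, if_true, Set.mem_singleton_iff] at hx hy
      exact absurd (Subtype.ext (hx.trans hy.symm)) hne
    · have hx := x.2
      simp only [rightHalf, h, if_false] at hx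
      exact hx.1.1.inv
  · rw [(inv_start x.1).1, (inv_start y.1).1]
    exact (rightHalf_finish Λ x.2).1.trans (rightHalf_finish Λ y.2).1.symm
  · rw [(inv_start x.1).2, (inv_start y.1).2]
    exact (rightHalf_finish Λ x.2).2.trans (rightHalf_finish Λ y.2).2.symm

end StringAlgebra

/-- A strict linear order is scattered if it admits no embedding of the order type of `ℚ`. -/
def IsScattered {α : Type*} (r : α → α → Prop) [IsStrictTotalOrder α r] : Prop :=
  IsEmpty ((fun a b : ℚ => a < b) ↪r r)

/-!
The strings `w x₀` extending a string `x₀` form a binary tree, which the hammock order reads from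
left to right: by the bisection a string has at most one extension by a direct and at most one by an
inverse syllable. Relations are directed paths of bounded length, so that a word `m` which is long,
or contains syllables of both kinds, is *synchronizing* (`IsSync`): whether `X m y` is a string
depends only on `X m` and on `m y`. Words leading from `m` back to `m` (`IsLoop`) can hence be
concatenated freely.

If `P` and `Q` are loops at `m` which do not commute, then `A = P Q` and `B = Q P` have the same
length and first differ in the sign of a syllable, say `A < B`. The words obtained by composing
copies of `A A` and `B B` and ending with `A` and `B` are then ordered like the nodes of the
infinite binary tree, that is, densely (`not_isScattered_of_loops`). Two different bands
`b`, `b'` in one class, joined by strings `b' v b` and `b w b'`, provide the loops `b` and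
`b w b' v`, `b w b' b' v` at `b`. If `b` commuted with both of the latter, then `w b' v` and
`w b' b' v` would be powers of the primitive word `b`, and comparing lengths would show that `b'` is
a rotation of `b`. So a visible nondomestic class makes the hammock nonscattered
(`not_isScattered_of_bands`).

Conversely, given a copy of `ℚ` in the hammock, call a string *big* if two members of the copy
extend it. By the pigeonhole principle along the path to a member in the middle, every big string
has an extension whose direct and inverse continuations are both big (`IsBig.exists_branching`).
There are finitely many words of a given synchronizing length. Consider a big string above which as
few of them as possible occur as endings of big strings; then all of these recur above both
continuations of a branching point, which gives two loops at the same `m` with different first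
syllables (`IsBig.exists_loops`). Every loop is a power of a rotation of a band, and the bands
belonging to `P`, `Q` and `P Q` are not all the same: otherwise these loops would be powers of
words of one length, and `P` and `Q` would be powers of the same word (`exists_bands_of_loops`).

The statement on right hammocks follows from the one on left hammocks by inversion, which maps bands
to bands.
-/

/-! ### Powers, roots and rotations of words -/

section ListPow

variable {α : Type*}

/-- The `n`-th power of a list, that is, the concatenation of `n` copies of it. -/
abbrev listPow (l : List α) (n : ℕ) : List α := (List.replicate n l).flatten

theorem listPow_succ (l : List α) (n : ℕ) : listPow l (n + 1) = l ++ listPow l n := by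
  simp [listPow, List.replicate_succ]

theorem listPow_add (l : List α) (m n : ℕ) : listPow l (m + n) = listPow l m ++ listPow l n := by
  rw [listPow, ← List.replicate_append_replicate, List.flatten_append]

theorem listPow_one (l : List α) : listPow l 1 = l := by simp [listPow]

theorem listPow_succ' (l : List α) (n : ℕ) : listPow l (n + 1) = listPow l n ++ l := by
  rw [listPow_add, listPow_one]

theorem length_listPow (l : List α) (n : ℕ) : (listPow l n).length = n * l.length := by
  simp [listPow]

theorem listPow_mul (l : List α) (m n : ℕ) : listPow l (m * n) = listPow (listPow l m) n := by
  induction n with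
  | zero => simp [listPow]
  | succ n ih => rw [Nat.mul_succ, listPow_add, ih, listPow_succ']

theorem listPow_pos_of_ne_nil {l : List α} {n : ℕ} (h : listPow l n ≠ []) : 0 < n :=
  Nat.pos_of_ne_zero fun h0 => h (by simp [h0])

/-- A list is primitive if it is not a proper power. The empty list is not primitive. -/
def IsPrimitive (l : List α) : Prop := ∀ c n, 2 ≤ n → l ≠ listPow c n

/-- Two commuting words are powers of the same word. -/
theorem exists_listPow_of_append_comm (x y : List α) (h : x ++ y = y ++ x) :
    ∃ r i j, x = listPow r i ∧ y = listPow r j := by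
  induction hn : x.length + y.length using Nat.strong_induction_on generalizing x y with
  | _ n ih =>
    subst hn
    -- the Euclidean algorithm on the lengths: strip the shorter word off the longer one
    have key : ∀ u v : List α, u.length + v.length = x.length + y.length → u ++ v = v ++ u →
        u ≠ [] → u.length ≤ v.length → ∃ r i j, u = listPow r i ∧ v = listPow r j := by
      intro u v hl huv hu hle
      have hp : u <+: v :=
        List.prefix_of_prefix_length_le (List.prefix_append u v) (huv ▸ List.prefix_append v u) hle
      obtain ⟨z, rfl⟩ := hp
      have hz : u ++ z = z ++ u := by simpa using huv
      have hpos := List.length_pos_of_ne_nil hu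
      obtain ⟨r, i, j, h1, h2⟩ := ih _ (by simp at hl; omega) u z hz rfl
      exact ⟨r, i, i + j, h1, by rw [listPow_add, ← h1, ← h2]⟩
    by_cases hx : x = []
    · exact ⟨y, 0, 1, by simp [hx], (listPow_one y).symm⟩
    by_cases hy : y = []
    · exact ⟨x, 1, 0, (listPow_one x).symm, by simp [hy]⟩
    rcases le_total x.length y.length with hle | hle
    · exact key x y rfl h hx hle
    · obtain ⟨r, i, j, h1, h2⟩ := key y x (Nat.add_comm _ _) h.symm hy hle
      exact ⟨r, j, i, h2, h1⟩

theorem IsPrimitive.eq_listPow_of_append_comm {x y : List α} (hx : IsPrimitive x)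
    (h : x ++ y = y ++ x) : ∃ j, y = listPow x j := by
  obtain ⟨r, i, j, h1, h2⟩ := exists_listPow_of_append_comm x y h
  have hi : ¬ 2 ≤ i := fun hi => hx r i hi h1
  have h0 : i ≠ 0 := fun h0 => hx [] 2 le_rfl (by simp [h1, h0])
  obtain rfl : i = 1 := by omega
  exact ⟨j, by rw [h2, h1, listPow_one]⟩

/-- Every nonempty word is a power of a primitive word. -/
theorem exists_primitive_root (x : List α) (hx : x ≠ []) :
    ∃ r k, IsPrimitive r ∧ x = listPow r k := by
  induction hn : x.length using Nat.strong_induction_on generalizing x with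
  | _ n ih =>
    subst hn
    by_cases hp : IsPrimitive x
    · exact ⟨x, 1, hp, (listPow_one x).symm⟩
    · simp only [IsPrimitive, not_forall, not_not] at hp
      obtain ⟨c, n, hn, hc⟩ := hp
      have hc0 : c ≠ [] := by rintro rfl; exact hx (by simp [hc])
      have hpos := List.length_pos_of_ne_nil hc0
      have hlen : c.length < x.length := by
        rw [hc, length_listPow]; nlinarith
      obtain ⟨r, k, hr, hk⟩ := ih _ hlen c hc0 rfl
      exact ⟨r, k * n, hr, by rw [listPow_mul, ← hk, hc]⟩

theorem append_listPow_append (u v : List α) (k : ℕ) :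
    u ++ listPow (v ++ u) k = listPow (u ++ v) k ++ u := by
  induction k with
  | zero => simp [listPow]
  | succ k ih =>
    rw [listPow_succ, listPow_succ, List.append_assoc (u ++ v), ← ih]
    simp

/-- A rotation of a power is the power of a rotation. -/
theorem List.IsRotated.exists_listPow {x r : List α} {k : ℕ} (h : listPow r k ~r x) :
    ∃ r', r' ~r r ∧ x = listPow r' k := by
  obtain ⟨n, rfl⟩ := h
  induction n with
  | zero => exact ⟨r, .refl r, by simp⟩
  | succ n ih =>
    obtain ⟨r', hr', h⟩ := ih
    rw [← List.rotate_rotate, h]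
    cases r' with
    | nil => exact ⟨[], hr', by simp⟩
    | cons a t =>
      cases k with
      | zero => exact ⟨_, hr', by simp [listPow]⟩
      | succ k =>
        refine ⟨t ++ [a], List.IsRotated.trans ⟨t.length, by simp⟩ hr', ?_⟩
        have := append_listPow_append t [a] k
        rw [listPow_succ, listPow_succ', List.cons_append, List.rotate_cons_succ,
          List.rotate_zero, ← List.append_assoc, ← this]
        simp

theorem List.IsRotated.infix_append_self {l l' : List α} (h : l ~r l') : l <:+: l' ++ l' := by
  obtain ⟨n, hn, rfl⟩ := List.isRotated_iff_mod.1 h.symm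
  rw [List.rotate_eq_drop_append_take hn]
  refine ⟨l'.take n, l'.drop n, ?_⟩
  rw [← List.append_assoc, List.take_append_drop, List.append_assoc, List.take_append_drop]

/-- A factor of a power of `b` whose length is a multiple of `|b|` is a power of a rotation
of `b`. -/
theorem exists_listPow_of_infix {u x v b : List α} {k d : ℕ} (h : u ++ x ++ v = listPow b k)
    (hx : x.length = d * b.length) : ∃ r, r ~r b ∧ x = listPow r d := by
  have hrot : listPow b k ~r x ++ (v ++ u) :=
    ⟨u.length, by rw [← h, List.append_assoc, List.rotate_append_length_eq, List.append_assoc]⟩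
  obtain ⟨r, hr, he⟩ := hrot.exists_listPow
  refine ⟨r, hr, ?_⟩
  have hlen : x.length = (listPow r d).length := by rw [length_listPow, hr.perm.length_eq, hx]
  have hadd : listPow r (d + k) = listPow r k ++ listPow r d := by rw [Nat.add_comm, listPow_add]
  -- compare the two prefixes of `r ^ (k + d)`
  rw [listPow_add, ← he, List.append_assoc] at hadd
  exact (List.append_inj_left hadd hlen.symm).symm

/-- If `P`, `Q` and `PQ` are powers of words of the same length, then `P` and `Q` are powers of the
same word. -/
theorem root_eq_of_append {p q s : List α} {k l m : ℕ} (hpq : p.length = s.length)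
    (hqs : q.length = s.length) (hk : 0 < k) (hl : 0 < l) (hm : 0 < m)
    (h : listPow p k ++ listPow q l = listPow s m) : p = q := by
  obtain ⟨k, rfl⟩ := Nat.exists_eq_succ_of_ne_zero hk.ne'
  obtain ⟨l, rfl⟩ := Nat.exists_eq_succ_of_ne_zero hl.ne'
  obtain ⟨m, rfl⟩ := Nat.exists_eq_succ_of_ne_zero hm.ne'
  have h1 : p = s := by
    rw [Nat.succ_eq_add_one, listPow_succ p, Nat.succ_eq_add_one m, listPow_succ s,
      List.append_assoc] at h
    exact List.append_inj_left h hpq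
  have h2 : q = s := by
    rw [Nat.succ_eq_add_one l, listPow_succ' q, Nat.succ_eq_add_one m, listPow_succ' s,
      ← List.append_assoc] at h
    exact List.append_inj_right' h hqs
  rw [h1, h2]

/-- Comparison of two lists from the right. -/
theorem list_compare_suffix (A B : List α) : A = B ∨ (∃ b T, B = T ++ b :: A) ∨
    (∃ a S, A = S ++ a :: B) ∨
    ∃ P a b S T, a ≠ b ∧ A = S ++ a :: P ∧ B = T ++ b :: P := by
  rcases StringAlgebra.list_compare A.reverse B.reverse with
    h | ⟨b, T, h⟩ | ⟨b, T, h⟩ | ⟨P, a, b, S, T, hab, h, h'⟩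
  · exact .inl (List.reverse_injective h)
  · exact .inr (.inl ⟨b, T.reverse, by rw [← List.reverse_reverse B, h]; simp⟩)
  · exact .inr (.inr (.inl ⟨b, T.reverse, by rw [← List.reverse_reverse A, h]; simp⟩))
  · exact .inr (.inr (.inr ⟨P.reverse, a, b, S.reverse, T.reverse, hab,
      by rw [← List.reverse_reverse A, h]; simp, by rw [← List.reverse_reverse B, h']; simp⟩))

/-- A factor of `X m Y` is a factor of `X m` or of `m Y`, or it contains `m` together with a letter
on either side. -/
theorem infix_append_cases {f X m Y : List α} (h : f <:+: X ++ m ++ Y) :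
    f <:+: X ++ m ∨ f <:+: m ++ Y ∨ (m <:+: f ∧ m.length + 2 ≤ f.length) := by
  obtain ⟨s, t, h⟩ := h
  by_cases h1 : X.length ≤ s.length
  · refine .inr (.inl ?_)
    have hp : X <+: s := by
      refine List.prefix_of_prefix_length_le (l₃ := X ++ m ++ Y) ?_ ?_ h1
      · rw [List.append_assoc]; exact List.prefix_append _ _
      · rw [← h, List.append_assoc]; exact List.prefix_append _ _
    obtain ⟨s', rfl⟩ := hp
    exact ⟨s', t, by simpa using h⟩
  by_cases h2 : Y.length ≤ t.length
  · refine .inl ?_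
    have hp : Y <:+ t := by
      refine List.suffix_of_suffix_length_le (l₃ := X ++ m ++ Y) (List.suffix_append _ _) ?_ h2
      rw [← h]; exact List.suffix_append _ _
    obtain ⟨t', rfl⟩ := hp
    refine ⟨s, t', ?_⟩
    rw [← List.append_assoc] at h
    exact List.append_cancel_right h
  · refine .inr (.inr ?_)
    have hp : s <+: X := by
      refine List.prefix_of_prefix_length_le (l₃ := X ++ m ++ Y) ?_ ?_ (by omega)
      · rw [← h, List.append_assoc]; exact List.prefix_append _ _
      · rw [List.append_assoc]; exact List.prefix_append _ _
    have hq : t <:+ Y := by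
      refine List.suffix_of_suffix_length_le (l₃ := X ++ m ++ Y) ?_ (List.suffix_append _ _)
        (by omega)
      rw [← h]; exact List.suffix_append _ _
    obtain ⟨X', rfl⟩ := hp
    obtain ⟨Y', rfl⟩ := hq
    have hf : f = X' ++ m ++ Y' := by
      have : s ++ (f ++ t) = s ++ ((X' ++ m ++ Y') ++ t) := by simpa using h
      exact List.append_cancel_right (List.append_cancel_left this)
    refine ⟨⟨X', Y', hf.symm⟩, ?_⟩
    rw [hf]
    simp at h1 h2 ⊢
    have := List.length_pos_of_ne_nil h1
    have := List.length_pos_of_ne_nil h2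
    omega

end ListPow

theorem List.IsRotated.exists_append {α : Type*} {l l' : List α} (h : l ~r l') :
    ∃ u v, l' = u ++ v ∧ l = v ++ u := by
  obtain ⟨n, hn, rfl⟩ := List.isRotated_iff_mod.1 h.symm
  exact ⟨l'.take n, l'.drop n, (List.take_append_drop n l').symm,
    List.rotate_eq_drop_append_take hn⟩

theorem append_self_infix_listPow {α : Type*} (r : List α) {k : ℕ} (hk : 0 < k) :
    r ++ r <:+: listPow r k ++ listPow r k := by
  obtain ⟨k, rfl⟩ := Nat.exists_eq_succ_of_ne_zero hk.ne'
  refine ⟨listPow r k, listPow r k, ?_⟩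
  rw [Nat.succ_eq_add_one]
  calc listPow r k ++ (r ++ r) ++ listPow r k = (listPow r k ++ r) ++ (r ++ listPow r k) := by simp
    _ = _ := by rw [← listPow_succ', ← listPow_succ]

namespace Syllable

variable {E : Type*}

/-- Moves the inverse syllables after the last direct one cyclically to the other end of the word. -/
theorem exists_rotation_aux (W : List (Syllable E)) :
    ∀ (V : List (Syllable E)) (c : E), (∃ a, direct a ∈ W) →
      ∃ a' T c', (direct a' :: T ++ [inverse c']) ~r (W ++ V ++ [inverse c]) := by
  induction W with
  | nil => simp
  | cons e W ih =>
    intro V c h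
    cases e with
    | direct a => exact ⟨a, W ++ V, c, by simpa using List.IsRotated.refl _⟩
    | inverse e =>
      obtain ⟨a, ha⟩ := h
      obtain ⟨a', T, c', h'⟩ := ih (V ++ [inverse c]) e ⟨a, by simpa using ha⟩
      refine ⟨a', T, c', h'.trans (List.IsRotated.symm ⟨1, by simp⟩)⟩

/-- A cyclic word with syllables of both kinds has a rotation which ends in a direct syllable and
begins with an inverse one. -/
theorem exists_rotation {P : List (Syllable E)} {a c : E} (ha : direct a ∈ P)
    (hc : inverse c ∈ P) : ∃ a' T c', (direct a' :: T ++ [inverse c']) ~r P := by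
  obtain ⟨X, Y, rfl⟩ := List.append_of_mem hc
  obtain ⟨a', T, c', h⟩ := exists_rotation_aux (Y ++ X) [] c
    ⟨a, by simpa [or_comm] using ha⟩
  refine ⟨a', T, c', h.trans ?_⟩
  have : (inverse c :: Y ++ X) ~r (X ++ inverse c :: Y) := List.isRotated_append
  exact .trans (.symm ⟨1, by simp⟩) this

theorem exists_map_direct {l : List (Syllable E)} (h : ∀ c, inverse c ∉ l) :
    ∃ q : List E, l = q.map direct := by
  induction l with
  | nil => exact ⟨[], rfl⟩
  | cons x l ih =>
    obtain ⟨q, rfl⟩ := ih fun c hc => h c (List.mem_cons_of_mem _ hc)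
    cases x with
    | direct a => exact ⟨a :: q, rfl⟩
    | inverse c => exact absurd (List.mem_cons_self ..) (h c)

theorem exists_map_inverse {l : List (Syllable E)} (h : ∀ a, direct a ∉ l) :
    ∃ q : List E, l = q.map inverse := by
  induction l with
  | nil => exact ⟨[], rfl⟩
  | cons x l ih =>
    obtain ⟨q, rfl⟩ := ih fun c hc => h c (List.mem_cons_of_mem _ hc)
    cases x with
    | inverse a => exact ⟨a :: q, rfl⟩
    | direct c => exact absurd (List.mem_cons_self ..) (h c)

end Syllable

/-! ### Strings as words avoiding forbidden factors -/

namespace StringAlgebra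

variable {V E : Type*} (Λ : StringAlgebra V E)

/-- The forbidden factors of strings: pairs of consecutive syllables which are not composable or
mutually inverse, the relations, and the inverses of the relations. -/
def IsForbidden (f : List (Syllable E)) : Prop :=
  (∃ β α, f = [β, α] ∧ (Λ.src β ≠ Λ.tgt α ∨ β = α.inv)) ∨
  ∃ p ∈ Λ.ρ, f = p.map Syllable.direct ∨ f = (p.map Syllable.inverse).reverse

/-- A list of syllables underlying a string: one without forbidden factors. -/
def IsStringList (l : List (Syllable E)) : Prop := ∀ f, Λ.IsForbidden f → ¬ f <:+: l

/-- A word is synchronizing if no forbidden factor contains it together with a syllable on either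
side, so that strings which overlap in it can be glued. -/
def IsSync (m : List (Syllable E)) : Prop :=
  ∀ f, Λ.IsForbidden f → m <:+: f → f.length < m.length + 2

/-- A loop at `m` is a word `P` such that `P m` is a string which ends in `m` again. Lists are in the
written order `αₙ ⋯ α₁`, so that the end of a string is a prefix of its list. -/
def IsLoop (m P : List (Syllable E)) : Prop := Λ.IsStringList (P ++ m) ∧ m <+: P ++ m

variable {Λ}

theorem isString_iff {x : Word V E} : Λ.IsString x ↔ Λ.IsStringList x.syl := by
  constructor
  · rintro ⟨h1, h2, h3, h4⟩ f (⟨β, α, rfl, h⟩ | ⟨p, hp, rfl | rfl⟩) ⟨s, t, hst⟩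
    · have hst' : x.syl = s ++ β :: α :: t := by simp [← hst]
      rcases h with h | h
      · exact h (List.isChain_iff_forall_rel_of_append_cons_cons.1 h1 hst')
      · exact List.isChain_iff_forall_rel_of_append_cons_cons.1 h4 hst' h
    · exact h2 p hp ⟨s, t, hst⟩
    · exact h3 p hp ⟨s, t, hst⟩
  · intro h
    refine ⟨List.isChain_iff_forall_rel_of_append_cons_cons.2 fun β α s t hst => ?_,
      fun p hp => h _ (.inr ⟨p, hp, .inl rfl⟩), fun p hp => h _ (.inr ⟨p, hp, .inr rfl⟩),
      List.isChain_iff_forall_rel_of_append_cons_cons.2 fun β α s t hst hi => ?_⟩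
    · by_contra hc
      exact h [β, α] (.inl ⟨β, α, rfl, .inl hc⟩) ⟨s, t, by simp [hst]⟩
    · exact h [β, α] (.inl ⟨β, α, rfl, .inr hi⟩) ⟨s, t, by simp [hst]⟩

theorem IsStringList.infix {l l' : List (Syllable E)} (h : Λ.IsStringList l) (h' : l' <:+: l) :
    Λ.IsStringList l' := fun f hf hfl => h f hf (hfl.trans h')

theorem IsStringList.glue {X m Y : List (Syllable E)} (hm : Λ.IsSync m)
    (h1 : Λ.IsStringList (X ++ m)) (h2 : Λ.IsStringList (m ++ Y)) :
    Λ.IsStringList (X ++ m ++ Y) := by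
  intro f hf hfi
  rcases infix_append_cases hfi with h | h | ⟨h, hl⟩
  · exact h1 f hf h
  · exact h2 f hf h
  · exact absurd (hm f hf h) (by omega)

/-- Relations are directed paths, so a word with syllables of both kinds is synchronizing. -/
theorem isSync_of_mixed {m : List (Syllable E)} {a c : E} (ha : Syllable.direct a ∈ m)
    (hc : Syllable.inverse c ∈ m) : Λ.IsSync m := by
  rintro f (⟨β, α, rfl, -⟩ | ⟨p, -, rfl | rfl⟩) h
  · have := List.length_pos_of_mem ha
    simp; omega
  · have := h.subset hc
    simp at this
  · have := h.subset ha
    simp at this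

variable (Λ) in
theorem exists_length_rel_le : ∃ M : ℕ, ∀ p ∈ Λ.ρ, p.length ≤ M := by
  obtain ⟨M, hM⟩ := Λ.exists_bound
  refine ⟨M, fun p hp => ?_⟩
  by_contra! hlt
  -- the tail of `p` contains a relation, which is a proper subpath of `p`
  cases p with
  | nil => simp at hlt
  | cons a q =>
    obtain ⟨r, hr, hi⟩ := hM q (Λ.rel_isPath _ hp).tail (by simpa using hlt)
    have h := Λ.rel_minimal _ hp r hr (hi.trans (List.suffix_cons a q).isInfix)
    have := hi.length_le
    rw [h] at this
    simp at this

variable (Λ) in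
theorem exists_isSync_of_le_length :
    ∃ N : ℕ, ∀ m : List (Syllable E), N ≤ m.length → Λ.IsSync m := by
  obtain ⟨M, hM⟩ := Λ.exists_length_rel_le
  refine ⟨M + 1, fun m hm => ?_⟩
  rintro f (⟨β, α, rfl, -⟩ | ⟨p, hp, rfl | rfl⟩) -
  · simp; omega
  · have := hM p hp
    simp; omega
  · have := hM p hp
    simp; omega

variable (Λ) in
/-- Since `⟨ρ⟩` is admissible, long strings have syllables of both kinds. -/
theorem exists_mixed_of_le_length : ∃ M : ℕ, ∀ l, Λ.IsStringList l → M ≤ l.length →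
    (∃ a, Syllable.direct a ∈ l) ∧ ∃ c, Syllable.inverse c ∈ l := by
  obtain ⟨M, hM⟩ := Λ.exists_bound
  refine ⟨M, fun l hl hlen => ?_⟩
  have hchain : l.IsChain (fun β α => Λ.src β = Λ.tgt α) :=
    List.isChain_iff_forall_rel_of_append_cons_cons.2 fun β α s t hst => by
      by_contra hc
      exact hl [β, α] (.inl ⟨β, α, rfl, .inl hc⟩) ⟨s, t, by simp [hst]⟩
  constructor
  · by_contra! h
    obtain ⟨q, rfl⟩ := Syllable.exists_map_inverse h
    have hq : q.reverse.IsChain (fun b a => Λ.s b = Λ.t a) := by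
      rw [List.isChain_reverse]
      exact (List.isChain_map _ |>.1 hchain).imp fun _ _ h => h.symm
    obtain ⟨r, hr, hi⟩ := hM _ hq (by simpa using hlen)
    refine hl _ (.inr ⟨r, hr, .inr rfl⟩) ?_
    have := List.reverse_infix.2 (hi.map Syllable.inverse)
    simpa using this
  · by_contra! h
    obtain ⟨q, rfl⟩ := Syllable.exists_map_direct h
    obtain ⟨r, hr, hi⟩ := hM _ (List.isChain_map _ |>.1 hchain) (by simpa using hlen)
    exact hl _ (.inr ⟨r, hr, .inl rfl⟩) (hi.map _)

/-! ### Loops and bands -/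

theorem IsLoop.extend {m P y : List (Syllable E)} (hm : Λ.IsSync m) (hP : Λ.IsLoop m P)
    (h : Λ.IsStringList (m ++ y)) : Λ.IsStringList (P ++ (m ++ y)) := by
  rw [← List.append_assoc]
  exact hP.1.glue hm h

theorem IsLoop.append {m P P' : List (Syllable E)} (hm : Λ.IsSync m) (hP : Λ.IsLoop m P)
    (hP' : Λ.IsLoop m P') : Λ.IsLoop m (P ++ P') := by
  obtain ⟨h1, t, ht⟩ := hP'
  refine ⟨?_, hP.2.trans ⟨t, ?_⟩⟩
  · rw [List.append_assoc, ← ht]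
    exact hP.extend hm (ht ▸ h1)
  · rw [List.append_assoc, List.append_assoc, ht]

theorem IsLoop.pow {m P : List (Syllable E)} (hm : Λ.IsSync m) (hP : Λ.IsLoop m P) (k : ℕ)
    (hk : 0 < k) : Λ.IsLoop m (listPow P k) := by
  induction k, hk using Nat.le_induction with
  | base => rwa [listPow_one]
  | succ k _ ih => rw [listPow_succ]; exact hP.append hm ih

theorem IsLoop.isStringList {m P : List (Syllable E)} (hP : Λ.IsLoop m P) :
    Λ.IsStringList P := hP.1.infix (List.prefix_append _ _).isInfix

theorem IsLoop.mixed {m P : List (Syllable E)} (hm : Λ.IsSync m) (hP : Λ.IsLoop m P)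
    (hne : P ≠ []) : (∃ a, Syllable.direct a ∈ P) ∧ ∃ c, Syllable.inverse c ∈ P := by
  obtain ⟨M, hM⟩ := Λ.exists_mixed_of_le_length
  have hlen : M ≤ (listPow P (M + 1)).length := by
    have := List.length_pos_of_ne_nil hne
    rw [length_listPow]; nlinarith
  have hsub : ∀ s, s ∈ listPow P (M + 1) → s ∈ P := fun s hs => by
    simp only [List.mem_flatten, List.mem_replicate] at hs
    obtain ⟨l, ⟨-, rfl⟩, hs⟩ := hs
    exact hs
  obtain ⟨⟨a, ha⟩, c, hc⟩ := hM _ (hP.pow hm (M + 1) M.succ_pos).isStringList hlen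
  exact ⟨⟨a, hsub _ ha⟩, c, hsub _ hc⟩

theorem start_eq_of_suffix {x y : Word V E} (hx : x.syl ≠ []) {l : List (Syllable E)}
    (h : y.syl = l ++ x.syl) : Λ.wsrc x = Λ.wsrc y ∧ Λ.wsig x = Λ.wsig y := by
  rw [Word.path_ext (by simp [hx]) h]
  cases x with
  | triv v i => exact absurd rfl hx
  | path m hm => simp [wsrc, wsig, Word.syl, hm]

/-- A string of positive length can be extended whenever this is possible on the level of
syllables. -/
theorem exists_extension {x : Word V E} (hx : x.syl ≠ []) {l : List (Syllable E)}
    (h : Λ.IsStringList (l ++ x.syl)) : ∃ y, Λ.IsString y ∧ y.syl = l ++ x.syl ∧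
      Λ.wsrc x = Λ.wsrc y ∧ Λ.wsig x = Λ.wsig y :=
  ⟨.path (l ++ x.syl) (by simp [hx]), isString_iff.2 h, rfl, start_eq_of_suffix hx rfl⟩

theorem exists_comp₃ {v x y : Word V E} (hy : Λ.IsString y) (hv : v.syl ≠ [])
    {l : List (Syllable E)} (h : y.syl = v.syl ++ (l ++ x.syl)) (hs : Λ.wsrc x = Λ.wsrc y)
    (hσ : Λ.wsig x = Λ.wsig y) : ∃ u, Λ.IsString u ∧ Λ.Comp₃ v u x y := by
  obtain ⟨z, hz, hzl, hzs, hzσ⟩ := exists_prefix hy _ _ h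
  obtain ⟨u, hu, -, huc⟩ := exists_split hz l hzl (hs.trans hzs.symm) (hσ.trans hzσ.symm)
  obtain ⟨v', -, hvl, hvc⟩ := exists_split (w := z) hy v.syl (by rw [h, hzl]) hzs hzσ
  obtain rfl : v' = v := by rw [Word.path_ext hv hvl, ← Word.path_ext hv rfl]
  exact ⟨u, hu, z, huc, hvc⟩

theorem Comp₃.syl_eq {v u x y : Word V E} (h : Λ.Comp₃ v u x y) :
    y.syl = v.syl ++ (u.syl ++ x.syl) := by
  obtain ⟨z, h1, h2⟩ := h
  rw [h2.syl_eq, h1.syl_eq]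

theorem bandLE_of_isStringList {b b' : Word V E} (hb : b.syl ≠ []) (hb' : b'.syl ≠ [])
    {l : List (Syllable E)} (h : Λ.IsStringList (b'.syl ++ l ++ b.syl)) : Λ.BandLE b b' := by
  obtain ⟨y, hy, hyl, hys, hyσ⟩ := exists_extension hb h
  obtain ⟨u, hu, hc⟩ := exists_comp₃ hy hb' (hyl.trans (List.append_assoc ..)) hys hyσ
  exact ⟨u, y, hu, hc, hy⟩

theorem BandLE.exists_isStringList {b b' : Word V E} (h : Λ.BandLE b b') :
    ∃ l, Λ.IsStringList (b'.syl ++ l ++ b.syl) := by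
  obtain ⟨u, y, -, hc, hy⟩ := h
  refine ⟨u.syl, ?_⟩
  rw [List.append_assoc, ← hc.syl_eq]
  exact isString_iff.1 hy

theorem IsBand.isPrimitive {b : Word V E} (hb : Λ.IsBand b) : IsPrimitive b.syl := by
  rintro c n hn h
  by_cases hc : c = []
  · have : b.syl = [] := by simp [h, hc]
    cases b with
    | triv v i => exact absurd hb.2.1 (by simp [Word.thetaR])
    | path l hl => exact hl this
  · have hci : c <:+: b.syl := by
      obtain ⟨k, rfl⟩ := Nat.exists_eq_add_of_le hn
      rw [h, listPow_add]
      exact ⟨[], c ++ listPow c k, by simp [listPow]⟩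
    exact hb.2.2.2.2 (.path c hc) (hb.1.infix hci) n hn h

theorem IsBand.syl_ne_nil {b : Word V E} (hb : Λ.IsBand b) : b.syl ≠ [] := by
  cases b with
  | triv v i => exact absurd hb.2.1 (by simp [Word.thetaR])
  | path l hl => exact hl

theorem IsBand.exists_direct_mem {b : Word V E} (hb : Λ.IsBand b) :
    ∃ a, Syllable.direct a ∈ b.syl := by
  cases b with
  | triv v i => exact absurd hb.2.1 (by simp [Word.thetaR])
  | path l hl =>
    have h := hb.2.1
    simp only [Word.thetaR] at h
    cases hh : l.head hl with
    | direct a => exact ⟨a, hh ▸ List.head_mem hl⟩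
    | inverse a => simp [hh, Syllable.sign] at h

theorem IsBand.exists_inverse_mem {b : Word V E} (hb : Λ.IsBand b) :
    ∃ a, Syllable.inverse a ∈ b.syl := by
  cases b with
  | triv v i => exact absurd hb.2.1 (by simp [Word.thetaR])
  | path l hl =>
    have h := hb.2.2.1
    simp only [Word.thetaL] at h
    cases hh : l.getLast hl with
    | inverse a => exact ⟨a, hh ▸ List.getLast_mem hl⟩
    | direct a => simp [hh, Syllable.sign] at h

theorem IsBand.isSync {b : Word V E} (hb : Λ.IsBand b) : Λ.IsSync b.syl := by
  obtain ⟨a, ha⟩ := hb.exists_direct_mem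
  obtain ⟨c, hc⟩ := hb.exists_inverse_mem
  exact isSync_of_mixed ha hc

theorem IsBand.isLoop {b : Word V E} (hb : Λ.IsBand b) : Λ.IsLoop b.syl b.syl := by
  obtain ⟨c, hc, hs⟩ := hb.2.2.2.1
  exact ⟨hc.syl_eq ▸ isString_iff.1 hs, List.prefix_append _ _⟩

/-- A primitive word `r` which ends in a direct and begins with an inverse syllable, and whose
square is a string, is a band. -/
theorem isBand_path {r : List (Syllable E)} (hr : r ≠ []) (hp : IsPrimitive r)
    (h2 : Λ.IsStringList (r ++ r)) (hhead : (r.head hr).sign = -1)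
    (hlast : (r.getLast hr).sign = 1) : Λ.IsBand (.path r hr) := by
  have hrr : Λ.IsString (.path (r ++ r) (by simp [hr]) : Word V E) := isString_iff.2 h2
  refine ⟨isString_iff.2 (h2.infix (List.prefix_append _ _).isInfix), hhead, hlast,
    ⟨.path (r ++ r) (by simp [hr]), .path r r hr hr ?_, hrr⟩, fun c _ n hn h => hp _ n hn h⟩
  have h1 := hrr.1
  simp only [Word.syl, List.isChain_append] at h1
  exact h1.2.2 _ (by simp [List.getLast?_eq_getLast_of_ne_nil hr]) _
    (by simp [List.head?_eq_some_head hr])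

/-- Every nonempty loop is a power of a rotation of a band. -/
theorem IsLoop.exists_band {Q₀ : Set (Word V E)} (hQ₀ : Λ.IsBandRepresentatives Q₀)
    {m P : List (Syllable E)} (hm : Λ.IsSync m) (hP : Λ.IsLoop m P) (hne : P ≠ []) :
    ∃ b ∈ Q₀, ∃ r k, 0 < k ∧ r.length = b.syl.length ∧ P = listPow r k ∧
      b.syl <:+: P ++ P := by
  obtain ⟨⟨a, ha⟩, c, hc⟩ := hP.mixed hm hne
  obtain ⟨a', T, c', hrot⟩ := Syllable.exists_rotation ha hc
  obtain ⟨r, k, hr, hk⟩ := exists_primitive_root (Syllable.direct a' :: T ++ [.inverse c'])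
    (by simp)
  have hk0 : 0 < k := listPow_pos_of_ne_nil (l := r) (by rw [← hk]; simp)
  have hr0 : r ≠ [] := fun h => hr [] 2 le_rfl (by simp [h])
  have hhead : r.head? = some (.direct a') := by
    rw [← List.head?_flatten_replicate hk0.ne' r]
    change (listPow r k).head? = _
    rw [← hk]; simp
  have hlast : r.getLast? = some (.inverse c') := by
    rw [← List.getLast?_flatten_replicate hk0.ne' r]
    change (listPow r k).getLast? = _
    rw [← hk]; exact List.getLast?_concat
  have hrr : Λ.IsStringList (r ++ r) := by
    obtain ⟨u, v, h1, h2⟩ := hrot.exists_append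
    refine (hP.pow hm 3 (by norm_num)).isStringList.infix
      ((append_self_infix_listPow r hk0).trans ⟨u, v, ?_⟩)
    rw [← hk, h2, h1]
    simp [listPow_succ]
  have hband : Λ.IsBand (.path r hr0) := by
    refine isBand_path hr0 hr hrr ?_ ?_
    · rw [List.head?_eq_some_head hr0, Option.some_inj] at hhead
      rw [hhead]; rfl
    · rw [List.getLast?_eq_getLast_of_ne_nil hr0, Option.some_inj] at hlast
      rw [hlast]; rfl
  obtain ⟨b, ⟨hbQ, hbr⟩, -⟩ := hQ₀.2 _ hband
  obtain ⟨r', hr', hPr'⟩ := (hk ▸ hrot).exists_listPow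
  have hbr' : b.syl ~r r' := hbr.trans hr'.symm
  exact ⟨b, hbQ, r', k, hk0, hbr'.perm.length_eq.symm, hPr',
    hPr' ▸ hbr'.infix_append_self.trans (append_self_infix_listPow r' hk0)⟩

end StringAlgebra

/-! ### Hammocks and the comparison of strings -/

namespace StringAlgebra

variable {V E : Type*} {Λ : StringAlgebra V E}

theorem mem_leftHalf {i : SignType} {x₀ x : Word V E} (hx : Λ.IsString x)
    (hs : Λ.wsrc x₀ = Λ.wsrc x) (hσ : Λ.wsig x₀ = Λ.wsig x) {S : List (Syllable E)}
    {α : Syllable E} (h : x.syl = S ++ α :: x₀.syl) (hi : α.sign = i) : x ∈ Λ.leftHalf i x₀ := by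
  have hi0 : i ≠ 0 := by
    subst hi
    cases α <;> simp [Syllable.sign]
  obtain ⟨w, hw, hwl, hwc⟩ := exists_split hx (S ++ [α]) (by simpa using h) hs hσ
  simp only [leftHalf, hi0, if_false]
  refine ⟨⟨hx, w, hw, hwc⟩, .inr ⟨w, hw, by simp [Word.length, hwl], hwc, ?_⟩⟩
  rw [Word.path_ext (by simp) hwl]
  simpa [Word.thetaL] using hi

theorem exists_of_mem_leftHalf {i : SignType} {x₀ x : Word V E} (h : x ∈ Λ.leftHalf i x₀)
    (hne : x ≠ x₀) : Λ.IsString x ∧ ∃ S α, x.syl = S ++ α :: x₀.syl ∧ α.sign = i := by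
  unfold leftHalf at h
  split_ifs at h with h0
  · exact absurd h hne
  · obtain ⟨⟨hx, -⟩, h | ⟨w, -, hlen, hwc, hi⟩⟩ := h
    · exact absurd h hne
    · refine ⟨hx, ?_⟩
      cases w with
      | triv v j => simp [Word.length, Word.syl] at hlen
      | path l hl =>
        refine ⟨l.dropLast, l.getLast hl, ?_, hi⟩
        rw [hwc.syl_eq]
        nth_rw 1 [Word.syl, ← List.dropLast_append_getLast hl]
        simp

/-- A list of syllables which underlies a string with the same starting data as `x₀`. -/
def IsBased (Λ : StringAlgebra V E) (x₀ : Word V E) (l : List (Syllable E)) : Prop :=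
  ∃ x, Λ.IsString x ∧ x.syl = l ∧ Λ.wsrc x₀ = Λ.wsrc x ∧ Λ.wsig x₀ = Λ.wsig x

theorem IsBased.isStringList {x₀ : Word V E} {l : List (Syllable E)} (h : Λ.IsBased x₀ l) :
    Λ.IsStringList l := by
  obtain ⟨x, hx, rfl, -⟩ := h
  exact isString_iff.1 hx

theorem IsBased.extend {x₀ : Word V E} {l l' : List (Syllable E)} (h : Λ.IsBased x₀ l)
    (hl : l ≠ []) (h' : Λ.IsStringList (l' ++ l)) : Λ.IsBased x₀ (l' ++ l) := by
  obtain ⟨x, hx, rfl, hs, hσ⟩ := h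
  obtain ⟨y, hy, hyl, hys, hyσ⟩ := exists_extension hl h'
  exact ⟨y, hy, hyl, hs.trans hys, hσ.trans hyσ⟩

/-- The bisection determines a syllable from its sign and the syllables before it. -/
theorem IsBased.sign_ne {x₀ : Word V E} {S T P : List (Syllable E)} {a b : Syllable E}
    (h : Λ.IsBased x₀ (S ++ a :: P)) (h' : Λ.IsBased x₀ (T ++ b :: P)) (hab : a ≠ b) :
    a.sign ≠ b.sign := by
  obtain ⟨x, hx, hxl, hxs, hxσ⟩ := h
  obtain ⟨y, hy, hyl, hys, hyσ⟩ := h'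
  obtain ⟨w, hw, rfl, hws, hwσ⟩ := exists_prefix hx (S ++ [a]) P (by simpa using hxl)
  obtain ⟨p1, p2, -⟩ := hx.next₃ hxl hws hwσ
  obtain ⟨q1, q2, -⟩ := hy.next₃ hyl (hws.trans (hxs.symm.trans hys))
    (hwσ.trans (hxσ.symm.trans hyσ))
  exact fun h0 => hab (syllable_ext (p1.trans q1.symm) (p2.trans q2.symm) h0)

/-- `l` and `l'` agree up to a point where `l` continues with a direct and `l'` with an inverse
syllable. -/
def Diverges (l l' : List (Syllable E)) : Prop :=
  ∃ S T P a b, l = S ++ Syllable.direct a :: P ∧ l' = T ++ Syllable.inverse b :: P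

theorem Diverges.append_left {l l' : List (Syllable E)} (h : Diverges l l')
    (u u' : List (Syllable E)) : Diverges (u ++ l) (u' ++ l') := by
  obtain ⟨S, T, P, a, b, rfl, rfl⟩ := h
  exact ⟨u ++ S, u' ++ T, P, a, b, by simp, by simp⟩

theorem Diverges.append_right {l l' : List (Syllable E)} (h : Diverges l l')
    (u : List (Syllable E)) : Diverges (l ++ u) (l' ++ u) := by
  obtain ⟨S, T, P, a, b, rfl, rfl⟩ := h
  exact ⟨S, T, P ++ u, a, b, by simp, by simp⟩

theorem leftLT_of_diverges {x y : Word V E} (hx : Λ.IsString x) (hy : Λ.IsString y)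
    (hs : Λ.wsrc x = Λ.wsrc y) (hσ : Λ.wsig x = Λ.wsig y) (h : Diverges x.syl y.syl) :
    Λ.leftLT x y := by
  obtain ⟨S, T, P, a, b, hxl, hyl⟩ := h
  obtain ⟨w, hw, rfl, hws, hwσ⟩ := exists_prefix hx (S ++ [.direct a]) P (by simpa using hxl)
  obtain ⟨-, -, v, hv, hvc⟩ := hx.next₃ hxl hws hwσ
  obtain ⟨-, -, u, hu, huc⟩ := hy.next₃ hyl (hws.trans hs) (hwσ.trans hσ)
  exact .inr (.inr ⟨u, v, w, b, a, hu, hv, hw, hvc, huc⟩)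

/-- Two based words of the same length are equal or diverge. -/
theorem IsBased.diverges_or {x₀ : Word V E} {A B R : List (Syllable E)}
    (hA : Λ.IsBased x₀ (A ++ R)) (hB : Λ.IsBased x₀ (B ++ R)) (hlen : A.length = B.length)
    (hne : A ≠ B) : Diverges A B ∨ Diverges B A := by
  rcases list_compare_suffix A B with h | ⟨b, T, h⟩ | ⟨a, S, h⟩ | ⟨P, a, b, S, T, hab, rfl, rfl⟩
  · exact absurd h hne
  · simp [h] at hlen; omega
  · simp [h] at hlen; omega
  · have hsign : a.sign ≠ b.sign := by
      refine IsBased.sign_ne (Λ := Λ) (x₀ := x₀) (S := S) (T := T) (P := P ++ R) ?_ ?_ hab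
      · simpa using hA
      · simpa using hB
    cases a with
    | direct a =>
      cases b with
      | direct b => exact absurd rfl hsign
      | inverse b => exact .inl ⟨S, T, P, a, b, rfl, rfl⟩
    | inverse a =>
      cases b with
      | direct b => exact .inr ⟨T, S, P, b, a, rfl, rfl⟩
      | inverse b => exact absurd rfl hsign

/-! ### A dense family of words -/

/-- The words obtained from binary sequences by replacing `false` by `A A` and `true` by `B B`. -/
def binaryWord (A B : List (Syllable E)) : List Bool → List (Syllable E)
  | [] => []
  | s :: t => (bif s then B ++ B else A ++ A) ++ binaryWord A B t

theorem binaryWord_append (A B : List (Syllable E)) (s t : List Bool) :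
    binaryWord A B (s ++ t) = binaryWord A B s ++ binaryWord A B t := by
  induction s with
  | nil => rfl
  | cons a s ih => simp [binaryWord, ih]

/-- The binary word of `s` followed by `A` and `B`. As this ending lies strictly between `A A` and
`B B`, none of these words is an initial part of another one, and they are ordered like the nodes
of the infinite binary tree. -/
def markedWord (A B : List (Syllable E)) (s : List Bool) : List (Syllable E) :=
  (B ++ A) ++ binaryWord A B s

section Dense

variable {A B : List (Syllable E)}

theorem diverges_markedWord_true (h : Diverges A B) (s T : List Bool) :
    Diverges (markedWord A B s) (markedWord A B (T ++ true :: s)) := by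
  have h1 : Diverges (B ++ A) (B ++ B) := h.append_left B B
  have := (h1.append_left [] ((B ++ A) ++ binaryWord A B T)).append_right (binaryWord A B s)
  simpa [markedWord, binaryWord_append, binaryWord] using this

theorem diverges_markedWord_false (h : Diverges A B) (s T : List Bool) :
    Diverges (markedWord A B (T ++ false :: s)) (markedWord A B s) := by
  have := ((h.append_right A).append_left ((B ++ A) ++ binaryWord A B T) []).append_right
    (binaryWord A B s)
  simpa [markedWord, binaryWord_append, binaryWord] using this

theorem diverges_markedWord_of_ne (h : Diverges A B) (s S T : List Bool) :
    Diverges (markedWord A B (S ++ false :: s)) (markedWord A B (T ++ true :: s)) := by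
  have := (((h.append_left A B).append_right []).append_left ((B ++ A) ++ binaryWord A B S)
    ((B ++ A) ++ binaryWord A B T)).append_right (binaryWord A B s)
  simpa [markedWord, binaryWord_append, binaryWord] using this

/-- The marked words form a dense linear order. -/
theorem markedWord_dense (h : Diverges A B) {s t : List Bool} (hst : s ≠ t) :
    (∃ u, Diverges (markedWord A B s) (markedWord A B u) ∧
      Diverges (markedWord A B u) (markedWord A B t)) ∨
    Diverges (markedWord A B t) (markedWord A B s) := by
  rcases list_compare_suffix s t with
    rfl | ⟨b, T, rfl⟩ | ⟨a, S, rfl⟩ | ⟨P, a, b, S, T, hab, rfl, rfl⟩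
  · exact absurd rfl hst
  · cases b with
    | true =>
      exact .inl ⟨false :: (T ++ true :: s), diverges_markedWord_true h s (false :: T),
        diverges_markedWord_false h _ []⟩
    | false => exact .inr (diverges_markedWord_false h s T)
  · cases a with
    | true => exact .inr (diverges_markedWord_true h t S)
    | false =>
      exact .inl ⟨true :: (S ++ false :: t), diverges_markedWord_true h _ [],
        diverges_markedWord_false h t (true :: S)⟩
  · cases a with
    | true =>
      obtain rfl : b = false := by simpa using hab.symm
      exact .inr (diverges_markedWord_of_ne h P T S)
    | false =>
      obtain rfl : b = true := by simpa using hab.symm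
      exact .inl ⟨true :: (S ++ false :: P), diverges_markedWord_true h _ [],
        diverges_markedWord_of_ne h P (true :: S) T⟩

theorem IsLoop.append_binaryWord {m : List (Syllable E)} (hm : Λ.IsSync m) (hA : Λ.IsLoop m A)
    (hB : Λ.IsLoop m B) (s : List Bool) :
    ∀ P, Λ.IsLoop m P → Λ.IsLoop m (P ++ binaryWord A B s) := by
  induction s with
  | nil => intro P hP; simpa [binaryWord] using hP
  | cons a s ih =>
    intro P hP
    rw [binaryWord, ← List.append_assoc]
    refine ih _ (hP.append hm ?_)
    cases a
    · exact hA.append hm hA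
    · exact hB.append hm hB

end Dense

theorem not_isScattered_of_dense {ι α : Type*} {r : α → α → Prop} [IsStrictTotalOrder α r]
    (f : ι → α) {a b : ι} (hab : r (f a) (f b))
    (hd : ∀ s t, r (f s) (f t) → ∃ u, r (f s) (f u) ∧ r (f u) (f t)) : ¬ IsScattered r := by
  classical
  intro hsc
  let _ : LinearOrder α := linearOrderOfSTO r
  have hr : ∀ x y : α, x < y ↔ r x y := fun _ _ => Iff.rfl
  have : Nontrivial (Set.range f) :=
    ⟨⟨_, a, rfl⟩, ⟨_, b, rfl⟩, fun h => ((hr _ _).2 hab).ne (congrArg Subtype.val h)⟩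
  have : DenselyOrdered (Set.range f) := by
    refine ⟨?_⟩
    rintro ⟨_, s, rfl⟩ ⟨_, t, rfl⟩ h
    obtain ⟨u, h1, h2⟩ := hd s t h
    exact ⟨⟨_, u, rfl⟩, h1, h2⟩
  obtain ⟨g⟩ := Order.embedding_from_countable_to_dense ℚ (Set.range f)
  exact hsc.elim ⟨⟨fun q => (g q).1, fun p q h => g.injective (Subtype.ext h)⟩,
    fun {p q} => (hr _ _).symm.trans (Iff.trans Iff.rfl g.lt_iff_lt)⟩

/-- Two loops which do not commute generate a copy of the rationals in the hammock. -/
theorem not_isScattered_of_loops {i : SignType} {x₀ : Word V E} {m y P Q S : List (Syllable E)}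
    {α : Syllable E} (hm : Λ.IsSync m) (hP : Λ.IsLoop m P) (hQ : Λ.IsLoop m Q)
    (hPQ : P ++ Q ≠ Q ++ P) (hb : Λ.IsBased x₀ (m ++ y)) (hy : m ++ y = S ++ α :: x₀.syl)
    (hi : α.sign = i) :
    ¬ IsScattered (fun x y : Λ.leftHalf i x₀ => Λ.leftLT x.1 y.1) := by
  have hext : ∀ L, Λ.IsLoop m L → Λ.IsBased x₀ (L ++ (m ++ y)) := fun L hL =>
    hb.extend (by simp [hy]) (hL.extend hm hb.isStringList)
  -- `P Q` and `Q P` have the same length, so that they diverge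
  obtain ⟨A, B, hA, hB, hAB⟩ : ∃ A B, Λ.IsLoop m A ∧ Λ.IsLoop m B ∧ Diverges A B := by
    have h1 := hP.append hm hQ
    have h2 := hQ.append hm hP
    rcases (hext _ h1).diverges_or (hext _ h2) (by simp [Nat.add_comm]) hPQ with h | h
    · exact ⟨_, _, h1, h2, h⟩
    · exact ⟨_, _, h2, h1, h⟩
  have hF : ∀ s, ∃ x : Λ.leftHalf i x₀, Λ.IsString x.1 ∧
      x.1.syl = markedWord A B s ++ (m ++ y) := fun s => by
    obtain ⟨x, hx, hxl, hs, hσ⟩ :=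
      hext _ (IsLoop.append_binaryWord hm hA hB s _ (hB.append hm hA))
    refine ⟨⟨x, mem_leftHalf (S := markedWord A B s ++ S) hx hs hσ ?_ hi⟩, hx, hxl⟩
    rw [hxl, hy]; simp [markedWord]
  choose f hf hfl using hF
  have hlt : ∀ s t, Diverges (markedWord A B s) (markedWord A B t) →
      Λ.leftLT (f s).1 (f t).1 := fun s t h => by
    refine leftLT_of_diverges (hf s) (hf t) ?_ ?_ ?_
    · exact (leftHalf_start Λ (f s).2).1.trans (leftHalf_start Λ (f t).2).1.symm
    · exact (leftHalf_start Λ (f s).2).2.trans (leftHalf_start Λ (f t).2).2.symm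
    · rw [hfl, hfl]; exact h.append_right _
  have hirr : ∀ x y : Λ.leftHalf i x₀, Λ.leftLT x.1 y.1 → ¬ Λ.leftLT y.1 x.1 := fun x y =>
    asymm_of (fun x y : Λ.leftHalf i x₀ => Λ.leftLT x.1 y.1)
  refine not_isScattered_of_dense f (hlt [] [true] (diverges_markedWord_true hAB [] []))
    fun s t hst => ?_
  have hne : s ≠ t := by rintro rfl; exact hirr _ _ hst hst
  rcases markedWord_dense hAB hne with ⟨u, h1, h2⟩ | h
  · exact ⟨u, hlt _ _ h1, hlt _ _ h2⟩
  · exact absurd hst (hirr _ _ (hlt _ _ h))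

/-- If the primitive word `b` commutes with both `w b' v` and `w b' b' v`, then these are powers of
`b`, and by their lengths the primitive word `b'` is a rotation of `b`. -/
theorem isRotated_of_append_comm {α : Type*} {b b' v w : List α} (hb : IsPrimitive b)
    (hb' : IsPrimitive b')
    (h1 : b ++ (w ++ b' ++ v) = (w ++ b' ++ v) ++ b)
    (h2 : b ++ (w ++ (b' ++ b') ++ v) = (w ++ (b' ++ b') ++ v) ++ b) : b ~r b' := by
  obtain ⟨k, hk⟩ := hb.eq_listPow_of_append_comm h1
  obtain ⟨l, hl⟩ := hb.eq_listPow_of_append_comm h2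
  have hk' := congrArg List.length hk
  have hl' := congrArg List.length hl
  rw [length_listPow] at hk' hl'
  simp only [List.length_append] at hk' hl'
  have hlen : b'.length = (l - k) * b.length := by rw [Nat.sub_mul]; omega
  obtain ⟨r, hr, he⟩ := exists_listPow_of_infix (u := w) (x := b') (v := b' ++ v)
    (by simpa using hl) hlen
  have hd : ¬ 2 ≤ l - k := fun hd => hb' r _ hd he
  have h0 : l - k ≠ 0 := fun h0 => hb' [] 2 le_rfl (by rw [he, h0]; simp [listPow])
  obtain hd1 : l - k = 1 := by omega
  rw [hd1, listPow_one] at he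
  exact he ▸ hr.symm

/-- A visible nondomestic class of bands makes the hammock nonscattered. -/
theorem not_isScattered_of_bands {Q₀ : Set (Word V E)} (hQ₀ : Λ.IsBandRepresentatives Q₀)
    {i : SignType} {x₀ b b' : Word V E} (hb' : b' ∈ Q₀) (hne : b ≠ b') (h1 : Λ.BandLE b b')
    (h2 : Λ.BandLE b' b) (hv : b ∈ Λ.leftVisibleBands Q₀ i x₀) :
    ¬ IsScattered (fun x y : Λ.leftHalf i x₀ => Λ.leftLT x.1 y.1) := by
  obtain ⟨hb, u, y, -, hc, hy⟩ := hv
  have hB := hQ₀.1 b hb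
  have hB' := hQ₀.1 b' hb'
  have hyl := Comp₃.syl_eq hc
  have hyx : y ≠ x₀ := by
    rintro rfl
    have := congrArg List.length hyl
    have := List.length_pos_of_ne_nil hB.syl_ne_nil
    simp at *; omega
  obtain ⟨hys, S, α, hyS, hi⟩ := exists_of_mem_leftHalf hy hyx
  have hst := leftHalf_start Λ hy
  obtain ⟨v, hv⟩ := h1.exists_isStringList
  obtain ⟨w, hw⟩ := h2.exists_isStringList
  -- the loops `b w b' v` and `b w b' b' v` at `b`
  have hP1 : Λ.IsLoop b.syl (b.syl ++ (w ++ b'.syl ++ v)) := by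
    refine ⟨?_, by simp⟩
    have := hw.glue (Y := v ++ b.syl) hB'.isSync (by simpa using hv)
    simpa using this
  have hP2 : Λ.IsLoop b.syl (b.syl ++ (w ++ (b'.syl ++ b'.syl) ++ v)) := by
    refine ⟨?_, by simp⟩
    have h3 : Λ.IsStringList (b'.syl ++ b'.syl ++ (v ++ b.syl)) :=
      hB'.isLoop.1.glue hB'.isSync (by simpa using hv)
    have := hw.glue (Y := b'.syl ++ (v ++ b.syl)) hB'.isSync (by simpa using h3)
    simpa using this
  have hbased : Λ.IsBased x₀ (b.syl ++ (u.syl ++ x₀.syl)) :=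
    ⟨y, hys, hyl, hst.1.symm, hst.2.symm⟩
  have hS := hyl.symm.trans hyS
  by_cases hc1 : b.syl ++ (w ++ b'.syl ++ v) = (w ++ b'.syl ++ v) ++ b.syl
  · by_cases hc2 : b.syl ++ (w ++ (b'.syl ++ b'.syl) ++ v) = (w ++ (b'.syl ++ b'.syl) ++ v) ++ b.syl
    · have hrot := isRotated_of_append_comm hB.isPrimitive hB'.isPrimitive hc1 hc2
      exact absurd ((hQ₀.2 b' hB').unique ⟨hb, hrot⟩ ⟨hb', .refl _⟩) hne
    · refine not_isScattered_of_loops hB.isSync hB.isLoop hP2 (fun h => hc2 ?_) hbased hS hi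
      exact List.append_cancel_left (h.trans (List.append_assoc ..))
  · refine not_isScattered_of_loops hB.isSync hB.isLoop hP1 (fun h => hc1 ?_) hbased hS hi
    exact List.append_cancel_left (h.trans (List.append_assoc ..))

end StringAlgebra

/-! ### Branching in a copy of the rationals -/

namespace StringAlgebra

variable {V E : Type*} {Λ : StringAlgebra V E}

/-- The signs of the syllables of a list, read from the first syllable on and continued by `0`. -/
def signCode (l : List (Syllable E)) (n : ℕ) : SignType :=
  ((l.reverse[n]?).map Syllable.sign).getD 0

theorem signCode_lt_of_diverges {l l' : List (Syllable E)} (h : Diverges l l') :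
    toLex (signCode l) < toLex (signCode l') := by
  obtain ⟨S, T, P, a, b, rfl, rfl⟩ := h
  refine ⟨P.length, fun k hk => ?_, ?_⟩
  · simp [signCode, List.getElem?_append, hk]
  · simp [signCode, Syllable.sign]

theorem signCode_lt_inverse (S : List (Syllable E)) (a : E) (l : List (Syllable E)) :
    toLex (signCode l) < toLex (signCode (S ++ Syllable.inverse a :: l)) := by
  refine ⟨l.length, fun k hk => ?_, ?_⟩
  · simp [signCode, List.getElem?_append, hk]
  · simp [signCode, Syllable.sign]

theorem signCode_direct_lt (S : List (Syllable E)) (a : E) (l : List (Syllable E)) :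
    toLex (signCode (S ++ Syllable.direct a :: l)) < toLex (signCode l) := by
  refine ⟨l.length, fun k hk => ?_, ?_⟩
  · simp [signCode, List.getElem?_append, hk]
  · simp [signCode, Syllable.sign]

/-- The strings which begin with a given string form an interval. -/
theorem suffix_of_signCode_between {x₀ : Word V E} {l l₁ l₂ l₃ : List (Syllable E)}
    (h₁ : Λ.IsBased x₀ l₁) (h₂ : Λ.IsBased x₀ l₂)
    (h₁₂ : toLex (signCode l₁) < toLex (signCode l₂))
    (h₂₃ : toLex (signCode l₂) < toLex (signCode l₃)) (hl₁ : l <:+ l₁) (hl₃ : l <:+ l₃) :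
    l <:+ l₂ := by
  obtain ⟨U, rfl⟩ := hl₁
  obtain ⟨W, rfl⟩ := hl₃
  rcases list_compare_suffix l l₂ with
    h | ⟨b, T, rfl⟩ | ⟨a, S, rfl⟩ | ⟨P, a, b, S, T, hab, rfl, rfl⟩
  · exact h ▸ List.suffix_rfl
  · exact ⟨T ++ [b], by simp⟩
  · cases a with
    | direct a =>
      rw [← List.append_assoc W] at h₂₃
      exact absurd (signCode_direct_lt _ _ _) h₂₃.asymm
    | inverse a =>
      rw [← List.append_assoc U] at h₁₂
      exact absurd (signCode_lt_inverse _ _ _) h₁₂.asymm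
  · rw [← List.append_assoc] at h₁ h₁₂ h₂₃
    have hsign := h₁.sign_ne h₂ hab
    cases a with
    | direct a =>
      cases b with
      | direct b => exact absurd rfl hsign
      | inverse b =>
        exact absurd (signCode_lt_of_diverges ⟨_, _, P, a, b, rfl, rfl⟩) h₂₃.asymm
    | inverse a =>
      cases b with
      | direct b => exact absurd (signCode_lt_of_diverges ⟨_, _, P, b, a, rfl, rfl⟩) h₁₂.asymm
      | inverse b => exact absurd rfl hsign

/-- The longest common beginning `P` of two strings, and the way they continue after it. -/
theorem exists_common_suffix {x₀ : Word V E} {l l₁ l₂ : List (Syllable E)}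
    (h₁ : Λ.IsBased x₀ l₁) (h₂ : Λ.IsBased x₀ l₂)
    (hlt : toLex (signCode l₁) < toLex (signCode l₂)) (hl₁ : l <:+ l₁) (hl₂ : l <:+ l₂) :
    ∃ P, l <:+ P ∧ (l₁ = P ∨ ∃ S a, l₁ = S ++ Syllable.direct a :: P) ∧
      (l₂ = P ∨ ∃ T b, l₂ = T ++ Syllable.inverse b :: P) := by
  rcases list_compare_suffix l₁ l₂ with
    rfl | ⟨b, T, rfl⟩ | ⟨a, S, rfl⟩ | ⟨P, a, b, S, T, hab, rfl, rfl⟩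
  · exact absurd hlt (lt_irrefl _)
  · cases b with
    | direct b => exact absurd (signCode_direct_lt _ _ _) hlt.asymm
    | inverse b => exact ⟨l₁, hl₁, .inl rfl, .inr ⟨T, b, rfl⟩⟩
  · cases a with
    | direct a => exact ⟨l₂, hl₂, .inr ⟨S, a, rfl⟩, .inl rfl⟩
    | inverse a => exact absurd (signCode_lt_inverse _ _ _) hlt.asymm
  · have hlP : l <:+ P := by
      have hPa : P <:+ S ++ a :: P := ⟨S ++ [a], by simp⟩
      rcases le_or_gt l.length P.length with hle | hgt
      · exact List.suffix_of_suffix_length_le hl₁ hPa hle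
      · -- otherwise `l` ends both in `a P` and in `b P`
        have ha : a :: P <:+ l :=
          List.suffix_of_suffix_length_le (List.suffix_append _ _) hl₁ (by simpa using hgt)
        have hb : b :: P <:+ l :=
          List.suffix_of_suffix_length_le (List.suffix_append _ _) hl₂ (by simpa using hgt)
        have := (List.suffix_of_suffix_length_le ha hb (by simp)).eq_of_length (by simp)
        exact absurd (List.cons.inj this).1 hab
    have hsign := h₁.sign_ne h₂ hab
    cases a with
    | direct a =>
      cases b with
      | direct b => exact absurd rfl hsign
      | inverse b => exact ⟨P, hlP, .inr ⟨S, a, rfl⟩, .inr ⟨T, b, rfl⟩⟩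
    | inverse a =>
      cases b with
      | direct b =>
        exact absurd (signCode_lt_of_diverges ⟨_, _, P, b, a, rfl, rfl⟩) hlt.asymm
      | inverse b => exact absurd rfl hsign

section Big

/-- `l` is an initial part of two distinct members of the family `g` of strings. -/
def IsBig (g : ℚ → List (Syllable E)) (l : List (Syllable E)) : Prop :=
  ∃ p q, p ≠ q ∧ l <:+ g p ∧ l <:+ g q

variable {g : ℚ → List (Syllable E)} {x₀ : Word V E}

theorem IsBig.mono {l l' : List (Syllable E)} (h : IsBig g l) (hl : l' <:+ l) : IsBig g l' := by
  obtain ⟨p, q, hpq, hp, hq⟩ := h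
  exact ⟨p, q, hpq, hl.trans hp, hl.trans hq⟩

/-- Infinitely many strings which branch off a given one in a syllable of sign `s` contain two which
do so at the same place. -/
theorem exists_isBig_of_infinite (hg : Function.Injective g) (hb : ∀ p, Λ.IsBased x₀ (g p))
    {I : Set ℚ} (hI : I.Infinite) {c : ℚ} {l : List (Syllable E)} {s : SignType}
    {K : List (Syllable E) → Prop}
    (h : ∀ r ∈ I, ∃ P, l <:+ P ∧ P <:+ g c ∧ (g r = P ∨ ∃ S a, a.sign = s ∧ g r = S ++ a :: P) ∧
      K P) :
    ∃ P a, a.sign = s ∧ l <:+ P ∧ P <:+ g c ∧ K P ∧ IsBig g (a :: P) := by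
  have hfin : {P | P <:+ g c}.Finite := by
    refine (List.finite_toSet (g c).tails).subset fun P hP => ?_
    exact (List.mem_tails ..).2 hP
  have hI' : (I \ g ⁻¹' {P | P <:+ g c}).Infinite :=
    hI.sdiff (hfin.preimage hg.injOn)
  choose! φ h1 h2 h3 h4 using h
  obtain ⟨r, hr, r', hr', hne, he⟩ :=
    hI'.exists_ne_map_eq_of_mapsTo (f := φ) (fun r hr => h2 r hr.1) hfin
  have hcont : ∀ r ∈ I \ g ⁻¹' {P | P <:+ g c}, ∃ S a, a.sign = s ∧ g r = S ++ a :: φ r :=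
    fun r hr => (h3 r hr.1).resolve_left fun h => hr.2 (by
      change g r <:+ g c
      rw [h]; exact h2 r hr.1)
  obtain ⟨S, a, ha, hS⟩ := hcont r hr
  obtain ⟨S', a', ha', hS'⟩ := hcont r' hr'
  rw [← he] at hS'
  have haa : a = a' := by
    by_contra hn
    exact IsBased.sign_ne (hS ▸ hb r) (hS' ▸ hb r') hn (ha.trans ha'.symm)
  subst haa
  exact ⟨φ r, a, ha, h1 r hr.1, h2 r hr.1, h4 r hr.1, r, r', hne, ⟨S, hS.symm⟩, ⟨S', hS'.symm⟩⟩

theorem eq_of_append_cons_suffix {α : Type*} {T U P L : List α} {a b : α}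
    (h : L = T ++ a :: P) (h' : U ++ b :: P <:+ L) : a = b := by
  obtain ⟨W, rfl⟩ := h'
  have := List.append_inj_right' (s₁ := W ++ U) (t₁ := b :: P) (s₂ := T) (t₂ := a :: P)
    (by simpa using h) (by simp)
  exact (List.cons.inj this).1.symm

/-- Above each initial part shared by two members of the family there is a branching point, both
sides of which are again shared by two members. -/
theorem IsBig.exists_branching (hg : ∀ p q, p < q → toLex (signCode (g p)) < toLex (signCode (g q)))
    (hb : ∀ p, Λ.IsBased x₀ (g p)) {l : List (Syllable E)} (hl : IsBig g l) :
    ∃ w a b, l <:+ w ∧ IsBig g (Syllable.direct a :: w) ∧ IsBig g (Syllable.inverse b :: w) := by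
  have hinj : Function.Injective g := fun p q h => by
    by_contra hne
    rcases lt_or_gt_of_ne hne with h' | h' <;> exact (hg _ _ h').ne (by rw [h])
  obtain ⟨p, q, hpq, hp, hq⟩ : ∃ p q, p < q ∧ l <:+ g p ∧ l <:+ g q := by
    obtain ⟨p, q, hne, hp, hq⟩ := hl
    rcases lt_or_gt_of_ne hne with h | h
    exacts [⟨p, q, h, hp, hq⟩, ⟨q, p, h, hq, hp⟩]
  have hmid : ∀ r, p < r → r < q → l <:+ g r := fun r h1 h2 =>
    suffix_of_signCode_between (hb p) (hb r) (hg _ _ h1) (hg _ _ h2) hp hq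
  obtain ⟨c, hpc, hcq⟩ := exists_between hpq
  have hlc := hmid c hpc hcq
  have hsuf : ∀ {T P : List (Syllable E)} {x : Syllable E}, P <:+ T ++ x :: P :=
    fun {T P x} => ⟨T ++ [x], by simp⟩
  obtain ⟨P₁, a, ha, hlP₁, hP₁c, hc₁, hbig₁⟩ := exists_isBig_of_infinite hinj hb
    (Set.Ioo_infinite hpc) (c := c) (l := l) (s := -1)
    (K := fun P => g c = P ∨ ∃ T b, g c = T ++ Syllable.inverse b :: P) fun r hr => by
      obtain ⟨P, hP, h1, h2⟩ := exists_common_suffix (hb r) (hb c) (hg _ _ hr.2)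
        (hmid r hr.1 (hr.2.trans hcq)) hlc
      refine ⟨P, hP, ?_, h1.imp_right fun ⟨S, a, h⟩ => ⟨S, _, rfl, h⟩, h2⟩
      rcases h2 with h | ⟨T, b, h⟩ <;> rw [h]
      exact hsuf
  obtain ⟨P₂, b, hb', hlP₂, hP₂c, hc₂, hbig₂⟩ := exists_isBig_of_infinite hinj hb
    (Set.Ioo_infinite hcq) (c := c) (l := l) (s := 1)
    (K := fun P => g c = P ∨ ∃ T b, g c = T ++ Syllable.direct b :: P) fun r hr => by
      obtain ⟨P, hP, h1, h2⟩ := exists_common_suffix (hb c) (hb r) (hg _ _ hr.1)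
        hlc (hmid r (hpc.trans hr.1) hr.2)
      refine ⟨P, hP, ?_, h2.imp_right fun ⟨S, a, h⟩ => ⟨S, _, rfl, h⟩, h1⟩
      rcases h1 with h | ⟨T, b, h⟩ <;> rw [h]
      exact hsuf
  obtain ⟨a, rfl⟩ : ∃ a', a = Syllable.direct a' := by
    cases a with
    | direct a => exact ⟨a, rfl⟩
    | inverse a => simp [Syllable.sign] at ha
  obtain ⟨b, rfl⟩ : ∃ b', b = Syllable.inverse b' := by
    cases b with
    | inverse b => exact ⟨b, rfl⟩
    | direct b => simp [Syllable.sign] at hb'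
  -- the shorter one of `P₁`, `P₂` serves the purpose: if it is `P₁`, say, then `P₂` extends the
  -- inverse continuation of `P₁` along `g c`, which is therefore big as well
  have hlen : ∀ {P U : List (Syllable E)} {e : Syllable E}, U ++ e :: P <:+ g c → g c ≠ P := by
    intro P U e h he
    have := h.length_le
    rw [he] at this
    simp at this
    omega
  rcases List.suffix_or_suffix_of_suffix hP₁c hP₂c with ⟨U, hU⟩ | ⟨U, hU⟩ <;>
    rcases List.eq_nil_or_concat' U with rfl | ⟨U, e, rfl⟩
  · obtain rfl : P₁ = P₂ := by simpa using hU
    exact ⟨P₁, a, b, hlP₁, hbig₁, hbig₂⟩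
  · have hU' : U ++ e :: P₁ = P₂ := by simpa using hU
    have hs : U ++ e :: P₁ <:+ g c := hU' ▸ hP₂c
    obtain ⟨T, b', hT⟩ := hc₁.resolve_left (hlen hs)
    obtain rfl := eq_of_append_cons_suffix hT hs
    exact ⟨P₁, a, b', hlP₁, hbig₁, hbig₂.mono ⟨Syllable.inverse b :: U, by simp [← hU']⟩⟩
  · obtain rfl : P₂ = P₁ := by simpa using hU
    exact ⟨P₂, a, b, hlP₁, hbig₁, hbig₂⟩
  · have hU' : U ++ e :: P₂ = P₁ := by simpa using hU
    have hs : U ++ e :: P₂ <:+ g c := hU' ▸ hP₁c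
    obtain ⟨T, a', hT⟩ := hc₂.resolve_left (hlen hs)
    obtain rfl := eq_of_append_cons_suffix hT hs
    exact ⟨P₂, a', b, hlP₂, hbig₁.mono ⟨Syllable.direct a :: U, by simp [← hU']⟩, hbig₂⟩

instance [Finite E] : Finite (Syllable E) :=
  Finite.of_surjective (Sum.elim Syllable.direct Syllable.inverse : E ⊕ E → Syllable E) fun s => by
    cases s with
    | direct a => exact ⟨.inl a, rfl⟩
    | inverse a => exact ⟨.inr a, rfl⟩

/-- The words of length `N` (the states) in which the shared initial parts extending `y` end. -/
def states (g : ℚ → List (Syllable E)) (N : ℕ) (y : List (Syllable E)) :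
    Set (List (Syllable E)) := {s | ∃ z, IsBig g z ∧ y <:+ z ∧ s = z.take N}

theorem states_finite [Finite E] (N : ℕ) (y : List (Syllable E)) : (states g N y).Finite := by
  refine (List.finite_length_le (Syllable E) N).subset ?_
  rintro s ⟨z, -, -, rfl⟩
  simp

theorem states_anti {N : ℕ} {y y' : List (Syllable E)} (h : y <:+ y') :
    states g N y' ⊆ states g N y := by
  rintro s ⟨z, hz, hyz, rfl⟩
  exact ⟨z, hz, h.trans hyz, rfl⟩

theorem exists_isLoop_of_states {N : ℕ} (hb : ∀ p, Λ.IsStringList (g p)) {w : List (Syllable E)}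
    {x : Syllable E} (h : w.take N ∈ states g N (x :: w)) :
    N ≤ w.length ∧ ∃ P, Λ.IsLoop (w.take N) (P ++ [x]) := by
  obtain ⟨z, ⟨p, -, -, hzp, -⟩, ⟨P, rfl⟩, he⟩ := h
  have hN : N ≤ w.length := by
    have := congrArg List.length he
    simp at this; omega
  refine ⟨hN, P, ?_⟩
  have hpre : P ++ [x] ++ w.take N <+: P ++ x :: w :=
    ⟨w.drop N, by simp⟩
  refine ⟨(hb p).infix (hpre.isInfix.trans hzp.isInfix), ?_⟩
  refine List.prefix_of_prefix_length_le ?_ hpre (by simp; omega)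
  rw [he]
  exact List.take_prefix _ _

/-- After passing to a shared initial part from which as few states as possible can be reached, all
of these can be reached from both sides of a branching point. So there are two loops which begin
with different syllables. -/
theorem IsBig.exists_loops [Finite E]
    (hg : ∀ p q, p < q → toLex (signCode (g p)) < toLex (signCode (g q)))
    (hb : ∀ p, Λ.IsBased x₀ (g p)) {l : List (Syllable E)} (hl : IsBig g l) (N : ℕ) :
    ∃ m y P Q a b, m.length = N ∧ l <:+ m ++ y ∧ IsBig g (m ++ y) ∧
      Λ.IsLoop m (P ++ [Syllable.direct a]) ∧ Λ.IsLoop m (Q ++ [Syllable.inverse b]) := by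
  obtain ⟨y, ⟨hy, hly⟩, hmin⟩ := exists_minimalFor_of_wellFoundedLT
    (fun y => IsBig g y ∧ l <:+ y) (fun y => (states g N y).ncard) ⟨l, hl, List.suffix_rfl⟩
  have heq : ∀ z, IsBig g z → y <:+ z → states g N z = states g N y := fun z hz hyz =>
    Set.eq_of_subset_of_ncard_le (states_anti hyz)
      (by
        by_contra! hlt
        exact hlt.not_ge (hmin ⟨hz, hly.trans hyz⟩ hlt.le)) (states_finite N y)
  obtain ⟨w, a, b, hyw, ha, hb'⟩ := hy.exists_branching hg hb
  have hw := ha.mono (List.suffix_cons _ w)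
  have hmem : w.take N ∈ states g N y := ⟨w, hw, hyw, rfl⟩
  have hstr : ∀ p, Λ.IsStringList (g p) := fun p => (hb p).isStringList
  obtain ⟨hN, P, hP⟩ := exists_isLoop_of_states hstr
    ((heq _ ha (hyw.trans (List.suffix_cons _ w))).symm ▸ hmem)
  obtain ⟨-, Q, hQ⟩ := exists_isLoop_of_states hstr
    ((heq _ hb' (hyw.trans (List.suffix_cons _ w))).symm ▸ hmem)
  refine ⟨w.take N, w.drop N, P, Q, a, b, by simpa using hN, ?_, ?_, hP, hQ⟩
  · rw [List.take_append_drop]; exact hly.trans hyw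
  · rw [List.take_append_drop]; exact hw

end Big

/-! ### Two bands from two loops -/

theorem bandLE_of_loops {m X Y : List (Syllable E)} (hm : Λ.IsSync m) (hX : Λ.IsLoop m X)
    (hY : Λ.IsLoop m Y) {b b' : Word V E} (hb : b.syl ≠ []) (hb' : b'.syl ≠ [])
    (hbX : b.syl <:+: X ++ X) (hbY : b'.syl <:+: Y ++ Y) : Λ.BandLE b b' := by
  have h := ((hY.append hm hY).append hm (hX.append hm hX)).isStringList
  obtain ⟨s, t, hst⟩ := hbX
  obtain ⟨s', t', hst'⟩ := hbY
  refine bandLE_of_isStringList hb hb' (l := t' ++ s) (h.infix ⟨s', t, ?_⟩)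
  rw [← hst, ← hst']
  simp

/-- Two loops which begin with different syllables give rise to two different bands in the same
class: otherwise all of `P`, `Q` and `P Q` would be powers of rotations of one band. -/
theorem exists_bands_of_loops {Q₀ : Set (Word V E)} (hQ₀ : Λ.IsBandRepresentatives Q₀)
    {m P Q : List (Syllable E)} {α β : Syllable E} (hm : Λ.IsSync m)
    (hP : Λ.IsLoop m (P ++ [α])) (hQ : Λ.IsLoop m (Q ++ [β])) (hαβ : α ≠ β) :
    ∃ b ∈ Q₀, ∃ b' ∈ Q₀, b ≠ b' ∧ Λ.BandLE b b' ∧ Λ.BandLE b' b ∧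
      ∃ X, Λ.IsLoop m X ∧ b.syl <:+: X := by
  have key : ∀ {X Y b b'}, Λ.IsLoop m X → Λ.IsLoop m Y → b ∈ Q₀ → b' ∈ Q₀ →
      b.syl <:+: X ++ X → b'.syl <:+: Y ++ Y → b ≠ b' → ∃ b ∈ Q₀, ∃ b' ∈ Q₀, b ≠ b' ∧
      Λ.BandLE b b' ∧ Λ.BandLE b' b ∧ ∃ X, Λ.IsLoop m X ∧ b.syl <:+: X := by
    intro X Y b b' hX hY hb hb' hbX hbY hne
    have h := (hQ₀.1 b hb).syl_ne_nil
    have h' := (hQ₀.1 b' hb').syl_ne_nil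
    exact ⟨b, hb, b', hb', hne, bandLE_of_loops hm hX hY h h' hbX hbY,
      bandLE_of_loops hm hY hX h' h hbY hbX, X ++ X, hX.append hm hX, hbX⟩
  have hPQ := hP.append hm hQ
  obtain ⟨b₁, hb₁, r₁, k₁, hk₁, hr₁, hp₁, hi₁⟩ := hP.exists_band hQ₀ hm (by simp)
  obtain ⟨b₂, hb₂, r₂, k₂, hk₂, hr₂, hp₂, hi₂⟩ := hQ.exists_band hQ₀ hm (by simp)
  obtain ⟨b₃, hb₃, r₃, k₃, hk₃, hr₃, hp₃, hi₃⟩ := hPQ.exists_band hQ₀ hm (by simp)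
  by_cases h₁₃ : b₁ = b₃
  · by_cases h₂₃ : b₂ = b₃
    · subst h₁₃ h₂₃
      rw [hp₁, hp₂] at hp₃
      have h := root_eq_of_append (hr₁.trans hr₃.symm) (hr₂.trans hr₃.symm) hk₁ hk₂ hk₃ hp₃
      have e₁ := congrArg List.getLast? hp₁
      have e₂ := congrArg List.getLast? hp₂
      rw [List.getLast?_flatten_replicate hk₁.ne', List.getLast?_concat] at e₁
      rw [List.getLast?_flatten_replicate hk₂.ne', List.getLast?_concat, ← h, ← e₁] at e₂
      exact absurd (Option.some_inj.1 e₂).symm hαβ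
    · exact key hQ hPQ hb₂ hb₃ hi₂ hi₃ h₂₃
  · exact key hP hPQ hb₁ hb₃ hi₁ hi₃ h₁₃

theorem IsBased.of_suffix {x₀ : Word V E} {l l' : List (Syllable E)} (h : Λ.IsBased x₀ l)
    (hl : l' <:+ l) : Λ.IsBased x₀ l' := by
  obtain ⟨x, hx, rfl, hs, hσ⟩ := h
  obtain ⟨t, ht⟩ := hl
  obtain ⟨y, hy, hyl, hys, hyσ⟩ := exists_prefix hx _ _ ht.symm
  exact ⟨y, hy, hyl, hs.trans hys.symm, hσ.trans hyσ.symm⟩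

theorem mem_leftVisibleBands {Q₀ : Set (Word V E)} {i : SignType} {x₀ b : Word V E}
    (hb : b ∈ Q₀) (hb0 : b.syl ≠ []) {U S : List (Syllable E)} {α : Syllable E}
    (hi : α.sign = i) (h : Λ.IsBased x₀ (b.syl ++ (U ++ (S ++ α :: x₀.syl)))) :
    b ∈ Λ.leftVisibleBands Q₀ i x₀ := by
  obtain ⟨y, hy, hyl, hs, hσ⟩ := h
  obtain ⟨u, hu, hc⟩ := exists_comp₃ (l := U ++ (S ++ [α])) hy hb0 (by simpa using hyl) hs hσ
  exact ⟨hb, u, y, hu, hc, mem_leftHalf (S := b.syl ++ (U ++ S)) hy hs hσ (by simpa using hyl) hi⟩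

/-- A nonscattered hammock sees a nondomestic class of bands. -/
theorem exists_bands_of_not_isScattered [Finite E] {Q₀ : Set (Word V E)}
    (hQ₀ : Λ.IsBandRepresentatives Q₀) {x₀ : Word V E} (hx₀ : Λ.IsString x₀) {i : SignType}
    (h : ¬ IsScattered (fun x y : Λ.leftHalf i x₀ => Λ.leftLT x.1 y.1)) :
    ∃ b ∈ Q₀, ∃ b' ∈ Q₀, b ≠ b' ∧ Λ.BandLE b b' ∧ Λ.BandLE b' b ∧
      b ∈ Λ.leftVisibleBands Q₀ i x₀ := by
  rw [IsScattered, not_isEmpty_iff] at h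
  obtain ⟨f⟩ := h
  let g : ℚ → List (Syllable E) := fun p => (f p).1.syl
  have hg : ∀ p q, p < q → toLex (signCode (g p)) < toLex (signCode (g q)) := fun p q hpq =>
    code_lt_of_leftLT (f.map_rel_iff.2 hpq)
  have hb : ∀ p, Λ.IsBased x₀ (g p) := fun p => by
    have hs := leftHalf_start Λ (f p).2
    refine ⟨_, ?_, rfl, hs.1.symm, hs.2.symm⟩
    by_cases hp : (f p).1 = x₀
    · rwa [hp]
    · exact (exists_of_mem_leftHalf (f p).2 hp).1
  -- at most one member of the family is `x₀`; two others share their syllable next to `x₀`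
  obtain ⟨p, q, hpq, hp, hq⟩ : ∃ p q, p ≠ q ∧ (f p).1 ≠ x₀ ∧ (f q).1 ≠ x₀ := by
    have hinj : ∀ p q, (f p).1 = x₀ → (f q).1 = x₀ → p = q := fun p q hp hq =>
      f.injective (Subtype.ext (hp.trans hq.symm))
    by_cases h0 : (f 0).1 = x₀
    · exact ⟨1, 2, by norm_num, fun h => absurd (hinj _ _ h0 h) (by norm_num),
        fun h => absurd (hinj _ _ h0 h) (by norm_num)⟩
    by_cases h1 : (f 1).1 = x₀
    · exact ⟨0, 2, by norm_num, h0, fun h => absurd (hinj _ _ h1 h) (by norm_num)⟩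
    · exact ⟨0, 1, by norm_num, h0, h1⟩
  obtain ⟨-, S, α, hS, hα⟩ := exists_of_mem_leftHalf (f p).2 hp
  obtain ⟨-, T, β, hT, hβ⟩ := exists_of_mem_leftHalf (f q).2 hq
  obtain rfl : α = β := by
    by_contra hne
    have hbp : Λ.IsBased x₀ (S ++ α :: x₀.syl) := hS ▸ hb p
    have hbq : Λ.IsBased x₀ (T ++ β :: x₀.syl) := hT ▸ hb q
    exact hbp.sign_ne hbq hne (hα.trans hβ.symm)
  have hbig : IsBig g (α :: x₀.syl) := ⟨p, q, hpq, ⟨S, hS.symm⟩, ⟨T, hT.symm⟩⟩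
  obtain ⟨N, hN⟩ := Λ.exists_isSync_of_le_length
  obtain ⟨m, y, P, Q, a, b, hm, ⟨R, hR⟩, hmy, hP, hQ⟩ := hbig.exists_loops hg hb N
  have hsync := hN m hm.ge
  obtain ⟨r, -, -, hr, -⟩ := hmy
  have hbased := (hb r).of_suffix hr
  obtain ⟨b₁, hb₁, b₂, hb₂, hne, h12, h21, X, hX, s, t, hst⟩ :=
    exists_bands_of_loops hQ₀ hsync hP hQ (by simp)
  refine ⟨b₁, hb₁, b₂, hb₂, hne, h12, h21,
    mem_leftVisibleBands hb₁ (hQ₀.1 b₁ hb₁).syl_ne_nil (U := t) (S := R) hα ?_⟩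
  have hXb : Λ.IsBased x₀ (X ++ (m ++ y)) :=
    hbased.extend (by simp [← hR]) (hX.extend hsync hbased.isStringList)
  refine hXb.of_suffix ⟨s, ?_⟩
  rw [← hst, hR]
  simp

end StringAlgebra

/-! ### Domestic classes -/

namespace StringAlgebra

variable {V E : Type*} {Λ : StringAlgebra V E}

theorem BandLE.refl {b : Word V E} (hb : Λ.IsBand b) : Λ.BandLE b b := by
  refine bandLE_of_isStringList hb.syl_ne_nil hb.syl_ne_nil (l := []) ?_
  simpa using hb.isLoop.1

/-- All classes which meet `W` are domestic if and only if no band in `W` is equivalent to a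
different band. -/
theorem forall_isDomestic_iff {Q₀ : Set (Word V E)} (hQ₀ : Λ.IsBandRepresentatives Q₀)
    {W : Set (Word V E)} :
    (∀ B ∈ {B ∈ Λ.bandClasses Q₀ | (B ∩ W).Nonempty}, IsDomestic B) ↔
      ¬ ∃ b ∈ Q₀, ∃ b' ∈ Q₀, b ≠ b' ∧ Λ.BandLE b b' ∧ Λ.BandLE b' b ∧ b ∈ W := by
  constructor
  · rintro h ⟨b, hb, b', hb', hne, h1, h2, hW⟩
    have hbb := BandLE.refl (hQ₀.1 b hb)
    obtain ⟨c, hc⟩ := Set.encard_eq_one.1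
      (h {b' ∈ Q₀ | Λ.BandLE b b' ∧ Λ.BandLE b' b} ⟨⟨b, hb, rfl⟩, b, ⟨hb, hbb, hbb⟩, hW⟩)
    have e1 : b = c := hc.subset ⟨hb, hbb, hbb⟩
    have e2 : b' = c := hc.subset ⟨hb', h1, h2⟩
    exact hne (e1.trans e2.symm)
  · rintro h _ ⟨⟨b₀, hb₀, rfl⟩, b₁, ⟨hb₁, h01, h10⟩, hW⟩
    by_cases he : b₁ = b₀
    · subst he
      refine Set.encard_eq_one.2 ⟨b₁, Set.eq_singleton_iff_unique_mem.2 ⟨⟨hb₁, h01, h10⟩, ?_⟩⟩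
      rintro b₂ ⟨hb₂, h12, h21⟩
      by_contra hne
      exact h ⟨b₁, hb₁, b₂, hb₂, Ne.symm hne, h12, h21, hW⟩
    · exact absurd ⟨b₁, hb₁, b₀, hb₀, he, h10, h01, hW⟩ h

theorem isScattered_leftHalf_iff [Finite E] {Q₀ : Set (Word V E)}
    (hQ₀ : Λ.IsBandRepresentatives Q₀) {x₀ : Word V E} (hx₀ : Λ.IsString x₀) (i : SignType) :
    IsScattered (fun x y : Λ.leftHalf i x₀ => Λ.leftLT x.1 y.1) ↔
      ¬ ∃ b ∈ Q₀, ∃ b' ∈ Q₀, b ≠ b' ∧ Λ.BandLE b b' ∧ Λ.BandLE b' b ∧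
        b ∈ Λ.leftVisibleBands Q₀ i x₀ := by
  constructor
  · rintro h ⟨b, -, b', hb', hne, h1, h2, hv⟩
    exact not_isScattered_of_bands hQ₀ hb' hne h1 h2 hv h
  · intro h
    by_contra hs
    exact h (exists_bands_of_not_isScattered hQ₀ hx₀ hs)

/-! ### Inversion -/

theorem inv_finish (x : Word V E) : Λ.wtgt x.inv = Λ.wsrc x ∧ Λ.weps x.inv = Λ.wsig x := by
  have h := inv_start (Λ := Λ) x.inv
  rw [inv_inv] at h
  exact ⟨h.1.symm, h.2.symm⟩

theorem inv_injective : Function.Injective (Word.inv : Word V E → Word V E) :=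
  Function.LeftInverse.injective inv_inv

theorem inv_syl_ne_nil {x : Word V E} : x.inv.syl ≠ [] ↔ x.syl ≠ [] := by
  simp [inv_syl]

theorem Comp.inv {u x y : Word V E} (h : Λ.Comp u x y) : Λ.Comp x.inv u.inv y.inv := by
  cases h with
  | triv_left v i x ht hε =>
    exact .triv_right _ _ _ ((inv_start x).1.trans ht) ((inv_start x).2.trans (by simp [hε]))
  | triv_right u v i hs hσ =>
    exact .triv_left _ _ _ ((inv_finish u).1.trans hs) ((inv_finish u).2.trans hσ)
  | path l m hl hm h =>
    have hw := Comp.path (Λ := Λ) (m.map Syllable.inv).reverse (l.map Syllable.inv).reverse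
      (by simpa using hm) (by simpa using hl)
      (((inv_start (.path m hm)).1.trans h.symm).trans (inv_finish (.path l hl)).1.symm)
    have he : (Word.path (l ++ m) (by simp [hl]) : Word V E).inv =
        .path ((m.map Syllable.inv).reverse ++ (l.map Syllable.inv).reverse) (by simp [hm]) :=
      Word.path_ext _ (by rw [inv_syl]; simp [Word.syl])
    rw [he]
    exact hw

theorem sign_inv (α : Syllable E) : α.inv.sign = -α.sign := by cases α <;> rfl

theorem thetaL_inv (x : Word V E) : x.inv.thetaL = -x.thetaR := by
  cases x with
  | triv v i => rfl
  | path l hl => simp [Word.inv, Word.thetaL, Word.thetaR, sign_inv]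

theorem thetaR_inv (x : Word V E) : x.inv.thetaR = -x.thetaL := by
  have := thetaL_inv x.inv
  rw [inv_inv] at this
  rw [this, neg_neg]

theorem length_inv (x : Word V E) : x.inv.length = x.length := by
  simp [Word.length, inv_syl]

theorem inv_mem_leftHalf {i : SignType} {x₀ x : Word V E} (h : x ∈ Λ.rightHalf i x₀) :
    x.inv ∈ Λ.leftHalf (-i) x₀.inv := by
  unfold rightHalf at h
  unfold leftHalf
  split_ifs at h with h0
  · obtain rfl : x = x₀ := h
    simp [h0]
  · rw [if_neg (by simpa using h0)]
    obtain ⟨⟨hx, u, hu, hc⟩, h⟩ := h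
    refine ⟨⟨hx.inv, u.inv, hu.inv, hc.inv⟩, h.imp (congrArg _) ?_⟩
    rintro ⟨w, hw, hl, hc, hi⟩
    exact ⟨w.inv, hw.inv, by rwa [length_inv], hc.inv, by rw [thetaL_inv, hi]⟩

theorem inv_mem_rightHalf {i : SignType} {x₀ x : Word V E} (h : x ∈ Λ.leftHalf i x₀) :
    x.inv ∈ Λ.rightHalf (-i) x₀.inv := by
  unfold leftHalf at h
  unfold rightHalf
  split_ifs at h with h0
  · obtain rfl : x = x₀ := h
    simp [h0]
  · rw [if_neg (by simpa using h0)]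
    obtain ⟨⟨hx, u, hu, hc⟩, h⟩ := h
    refine ⟨⟨hx.inv, u.inv, hu.inv, hc.inv⟩, h.imp (congrArg _) ?_⟩
    rintro ⟨w, hw, hl, hc, hi⟩
    exact ⟨w.inv, hw.inv, by rwa [length_inv], hc.inv, by rw [thetaR_inv, hi]⟩

theorem inv_mem_leftHalf_iff {i : SignType} {x₀ x : Word V E} :
    x.inv ∈ Λ.leftHalf (-i) x₀.inv ↔ x ∈ Λ.rightHalf i x₀ := by
  refine ⟨fun h => ?_, inv_mem_leftHalf⟩
  have := inv_mem_rightHalf h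
  rwa [inv_inv, inv_inv, neg_neg] at this

theorem map_inv_reverse_listPow (l : List (Syllable E)) (n : ℕ) :
    ((listPow l n).map Syllable.inv).reverse = listPow (l.map Syllable.inv).reverse n := by
  induction n with
  | zero => simp [listPow]
  | succ n ih => rw [listPow_succ, listPow_succ', ← ih]; simp

theorem IsStringList.inv {l : List (Syllable E)} (h : Λ.IsStringList l) :
    Λ.IsStringList (l.map Syllable.inv).reverse := by
  by_cases hl : l = []
  · simpa [hl] using h
  · have hx : Λ.IsString (.path l hl : Word V E) := isString_iff.2 h
    exact isString_iff.1 hx.inv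

/-- The inverse of a band is a band: its last syllable is direct again, being the inverse of the
first syllable of the band. -/
theorem IsBand.inv {b : Word V E} (hb : Λ.IsBand b) : Λ.IsBand b.inv := by
  refine ⟨hb.1.inv, by rw [thetaR_inv, hb.2.2.1], by rw [thetaL_inv, hb.2.1]; rfl, ?_,
    fun c _ n hn h => ?_⟩
  · obtain ⟨c, hc, hs⟩ := hb.2.2.2.1
    exact ⟨c.inv, hc.inv, hs.inv⟩
  · refine hb.isPrimitive c.inv.syl n hn ?_
    rw [← inv_inv b, inv_syl, h, map_inv_reverse_listPow, inv_syl]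

theorem inv_isRotated {x y : Word V E} (h : x.syl ~r y.syl) : x.inv.syl ~r y.inv.syl := by
  rw [inv_syl, inv_syl]
  exact (h.map _).reverse

theorem IsBandRepresentatives.inv {Q₀ : Set (Word V E)} (hQ₀ : Λ.IsBandRepresentatives Q₀) :
    Λ.IsBandRepresentatives (Word.inv '' Q₀) := by
  constructor
  · rintro _ ⟨b, hb, rfl⟩
    exact (hQ₀.1 b hb).inv
  · intro b hb
    obtain ⟨c, ⟨hc, hcb⟩, huniq⟩ := hQ₀.2 _ hb.inv
    refine ⟨c.inv, ⟨⟨c, hc, rfl⟩, ?_⟩, ?_⟩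
    · rw [← inv_inv b]; exact inv_isRotated hcb
    · rintro _ ⟨⟨d, hd, rfl⟩, hdb⟩
      refine congrArg _ (huniq d ⟨hd, ?_⟩)
      rw [← inv_inv d]; exact inv_isRotated hdb

theorem BandLE.inv {b b' : Word V E} (hb : b.syl ≠ []) (hb' : b'.syl ≠ []) (h : Λ.BandLE b b') :
    Λ.BandLE b'.inv b.inv := by
  obtain ⟨l, hl⟩ := h.exists_isStringList
  refine bandLE_of_isStringList (inv_syl_ne_nil.2 hb') (inv_syl_ne_nil.2 hb)
    (l := (l.map Syllable.inv).reverse) ?_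
  have := hl.inv
  simpa [inv_syl] using this

theorem exists_split_right {x y : Word V E} (hy : Λ.IsString y) (l : List (Syllable E))
    (h : y.syl = x.syl ++ l) (ht : Λ.wtgt x = Λ.wtgt y) (hε : Λ.weps x = Λ.weps y) :
    ∃ u, Λ.IsString u ∧ u.syl = l ∧ Λ.Comp x u y := by
  obtain ⟨u, hu, hul, hc⟩ := exists_split (w := x.inv) hy.inv (l.map Syllable.inv).reverse
    (by simp [inv_syl, h]) (by rw [(inv_start x).1, (inv_start y).1, ht])
    (by rw [(inv_start x).2, (inv_start y).2, hε])
  refine ⟨u.inv, hu.inv, ?_, by simpa only [inv_inv] using hc.inv⟩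
  have hii : Syllable.inv ∘ Syllable.inv = (id : Syllable E → _) := funext Syllable.inv_inv
  simp [inv_syl, hul, hii]

theorem exists_comp₃_right {v x y : Word V E} (hy : Λ.IsString y) (hx : x.syl ≠ [])
    {l : List (Syllable E)} (h : y.syl = v.syl ++ (l ++ x.syl)) (ht : Λ.wtgt v = Λ.wtgt y)
    (hε : Λ.weps v = Λ.weps y) : ∃ u, Λ.IsString u ∧ Λ.Comp₃ v u x y := by
  obtain ⟨z, hz, hzl, hzc⟩ := exists_split_right hy _ h ht hε
  have hs := start_eq_of_suffix (Λ := Λ) hx hzl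
  obtain ⟨u, hu, -, huc⟩ := exists_split hz l hzl hs.1 hs.2
  exact ⟨u, hu, z, huc, hzc⟩

theorem inv_mem_leftVisibleBands_iff {Q₀ : Set (Word V E)} {i : SignType} {x₀ b : Word V E}
    (hb : b.syl ≠ []) : b.inv ∈ Λ.leftVisibleBands (Word.inv '' Q₀) (-i) x₀.inv ↔
      b ∈ Λ.rightVisibleBands Q₀ i x₀ := by
  constructor
  · rintro ⟨⟨b', hb', he⟩, u, y, -, hc, hy⟩
    obtain rfl := inv_injective he
    by_cases hyx : y = x₀.inv
    · -- `b⁻¹ u x₀⁻¹` is longer than `x₀⁻¹`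
      have hlen := congrArg List.length (Comp₃.syl_eq hc)
      have hpos := List.length_pos_of_ne_nil (inv_syl_ne_nil.2 hb)
      rw [hyx] at hlen
      simp only [List.length_append] at hlen
      omega
    have hys := (exists_of_mem_leftHalf hy hyx).1
    have hy' : y.inv ∈ Λ.rightHalf i x₀ := inv_mem_leftHalf_iff.1 (by rwa [inv_inv])
    have hf := rightHalf_finish Λ hy'
    have hyl : y.inv.syl = x₀.syl ++ (u.inv.syl ++ b'.syl) := by
      rw [inv_syl, Comp₃.syl_eq hc]
      nth_rw 2 [← inv_inv x₀, ← inv_inv b']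
      simp [inv_syl]
    obtain ⟨w, hw, hwc⟩ := exists_comp₃_right hys.inv hb hyl hf.1.symm hf.2.symm
    exact ⟨hb', w, _, hw, hwc, hy'⟩
  · rintro ⟨hb', u, y, -, hc, hy⟩
    have hyl := Comp₃.syl_eq hc
    have hf := rightHalf_finish Λ hy
    have hy' := inv_mem_leftHalf hy
    have hyx : y.inv ≠ x₀.inv := fun h => by
      have hlen := congrArg List.length hyl
      have hpos := List.length_pos_of_ne_nil hb
      rw [inv_injective h] at hlen
      simp only [List.length_append] at hlen
      omega
    have hys := (exists_of_mem_leftHalf hy' hyx).1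
    obtain ⟨w, hw, hwc⟩ := exists_comp₃ (v := b.inv) (x := x₀.inv) (l := u.inv.syl) hys
      (inv_syl_ne_nil.2 hb) (by simp [inv_syl, hyl])
      (by rw [(inv_start x₀).1, (inv_start y).1, hf.1])
      (by rw [(inv_start x₀).2, (inv_start y).2, hf.2])
    exact ⟨⟨b, hb', rfl⟩, w, _, hw, hwc, hy'⟩

theorem isScattered_congr {α β : Type*} {r : α → α → Prop} {s : β → β → Prop}
    [IsStrictTotalOrder α r] [IsStrictTotalOrder β s] (e : r ≃r s) :
    IsScattered r ↔ IsScattered s :=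
  ⟨fun h => ⟨fun f => h.elim (f.trans e.symm.toRelEmbedding)⟩,
    fun h => ⟨fun f => h.elim (f.trans e.toRelEmbedding)⟩⟩

/-- Inversion identifies the right half hammocks of `x₀` with the left ones of its inverse. -/
def rightHalfIso (Λ : StringAlgebra V E) (i : SignType) (x₀ : Word V E) :
    (fun x y : Λ.rightHalf i x₀ => Λ.rightLT x.1 y.1) ≃r
      (fun x y : Λ.leftHalf (-i) x₀.inv => Λ.leftLT x.1 y.1) where
  toFun x := ⟨x.1.inv, inv_mem_leftHalf x.2⟩
  invFun x := ⟨x.1.inv, inv_mem_leftHalf_iff.1 (by rw [inv_inv]; exact x.2)⟩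
  left_inv x := Subtype.ext (inv_inv x.1)
  right_inv x := Subtype.ext (inv_inv x.1)
  map_rel_iff' := Iff.rfl

theorem isScattered_rightHalf_iff [Finite E] {Q₀ : Set (Word V E)}
    (hQ₀ : Λ.IsBandRepresentatives Q₀) {x₀ : Word V E} (hx₀ : Λ.IsString x₀) (i : SignType) :
    IsScattered (fun x y : Λ.rightHalf i x₀ => Λ.rightLT x.1 y.1) ↔
      ¬ ∃ b ∈ Q₀, ∃ b' ∈ Q₀, b ≠ b' ∧ Λ.BandLE b b' ∧ Λ.BandLE b' b ∧
        b ∈ Λ.rightVisibleBands Q₀ i x₀ := by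
  rw [isScattered_congr (Λ.rightHalfIso i x₀), isScattered_leftHalf_iff hQ₀.inv hx₀.inv]
  have hnil : ∀ b ∈ Q₀, b.syl ≠ [] := fun b hb => (hQ₀.1 b hb).syl_ne_nil
  refine not_congr ⟨?_, ?_⟩
  · rintro ⟨_, ⟨b, hb, rfl⟩, _, ⟨b', hb', rfl⟩, hne, h1, h2, hv⟩
    have h1' := h1.inv (inv_syl_ne_nil.2 (hnil b hb)) (inv_syl_ne_nil.2 (hnil b' hb'))
    have h2' := h2.inv (inv_syl_ne_nil.2 (hnil b' hb')) (inv_syl_ne_nil.2 (hnil b hb))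
    rw [inv_inv, inv_inv] at h1' h2'
    exact ⟨b, hb, b', hb', fun h => hne (congrArg _ h), h2', h1',
      (inv_mem_leftVisibleBands_iff (hnil b hb)).1 hv⟩
  · rintro ⟨b, hb, b', hb', hne, h1, h2, hv⟩
    exact ⟨b.inv, ⟨b, hb, rfl⟩, b'.inv, ⟨b', hb', rfl⟩, fun h => hne (inv_injective h),
      h2.inv (hnil b' hb') (hnil b hb), h1.inv (hnil b hb) (hnil b' hb'),
      (inv_mem_leftVisibleBands_iff (hnil b hb)).2 hv⟩

end StringAlgebra

theorem mainTheorem8 {V E : Type*} [Finite V] [Finite E] (Λ : StringAlgebra V E)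
    (Q₀ : Set (Word V E)) (hQ₀ : Λ.IsBandRepresentatives Q₀)
    (x₀ : Word V E) (hx₀ : Λ.IsString x₀) (i : SignType) :
    (IsScattered (fun x y : Λ.leftHalf i x₀ => Λ.leftLT x.1 y.1) ↔
      ∀ B ∈ Λ.leftVisibleClasses Q₀ i x₀, StringAlgebra.IsDomestic B) ∧
    (IsScattered (fun x y : Λ.rightHalf i x₀ => Λ.rightLT x.1 y.1) ↔
      ∀ B ∈ Λ.rightVisibleClasses Q₀ i x₀, StringAlgebra.IsDomestic B) :=
  ⟨(StringAlgebra.isScattered_leftHalf_iff hQ₀ hx₀ i).trans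
    (StringAlgebra.forall_isDomestic_iff hQ₀).symm,
  (StringAlgebra.isScattered_rightHalf_iff hQ₀ hx₀ i).trans
    (StringAlgebra.forall_isDomestic_iff hQ₀).symm⟩
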